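/- **Definitions.** A *triply periodic skeletal graph* is a connected one-dimensional simplicial complex $\Gamma\subset\mathbb R^3$ (a simple graph, embedded with straight edges) that is invariant under a lattice $\Lambda\subset\mathbb R^3$ of rank three. We say that the quotient $\Gamma/\Lambda$ (in which loops and multiple edges are allowed) is of *type* $(g,\mathrm v,d)$ if it has $\mathrm v$ vertices, every vertex has degree $d$, and $g=\mathrm e-\mathrm v+1$, where $\mathrm e$ is the number of its edges. A *$\Lambda$-periodic Archimedean decoration* of $\Gamma$ replaces, $\Lambda$-equivariantly, each 0-simplex by a Platonic or Archimedean solid and each 1-simplex by a right prism or right antiprism over a regular polygon or by the empty solid. The solid of a 0-simplex and the non-empty solid of an incident 1-simplex meet exactly in a common two-dimensional face of both; if a 1-simplex is replaced by the empty solid, the solids of its two end points meet exactly in a common two-dimensional face of both. Such pairs of solids are called adjacent, and the intersection of two distinct non-adjacent solids has dimension at most one. It is also required that the union $P$ of all the solids contains $\Gamma$ and has $\Gamma$ as a deformation retract. The decoration is *regular* if, for some $p,q,r$, the boundary $\partial P$ is a connected surface, those faces of the solids along which no other solid is attached form an edge-to-edge tiling of $\partial P$ by regular $p$-gons with exactly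 $q$ of them at each vertex, and any two adjacent solids meet in a regular $r$-gon. **Theorem.** Consider all surfaces $S=\partial P\subset\mathbb R^3$ such that $P$ is the polyhedron of a $\Lambda$-periodic regular Archimedean decoration of a triply periodic skeletal graph $\Gamma$ with quotient $\Gamma/\Lambda$ of type $(3,1,6)$ or $(3,2,4)$, for any lattice $\Lambda$ of rank three, and such that the compact quotient $S/\Lambda$ has genus three. Up to similarity of $\mathbb R^3$ there are only finitely many such surfaces. In particular, only finitely many genus-three regular triply periodic polyhedral surfaces arise as regular Archimedean decorations of the symmetric quotient graphs $\Gamma'_{3,1,6}$ and $\Gamma'_{3,2,4}$. -/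

import Mathlib

open Set Topology

noncomputable section

namespace RegularDecoration

/-- Euclidean three-space. -/
abbrev E3 : Type := EuclideanSpace ℝ (Fin 3)

/-- Two subsets of space are similar if a similarity of space (a composition of an isometry,
possibly orientation reversing, and a scaling) carries one onto the other. -/
def IsSimilar (A B : Set E3) : Prop :=
  ∃ f : E3 ≃ᵈ E3, f '' A = B

/-! ### Convex polyhedra, faces, polygons, prisms -/

/-- A solid convex polyhedron: the hull of finitely many points, with non-empty interior. -/
def IsConvexPolyhedron (K : Set E3) : Prop :=
  (∃ A : Set E3, A.Finite ∧ K = convexHull ℝ A) ∧ (interior K).Nonempty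

/-- `F` is a `k`-dimensional face of the convex polytope `K`. -/
def IsFace (k : ℕ) (K F : Set E3) : Prop :=
  F.Nonempty ∧ IsExposed ℝ K F ∧ Module.finrank ℝ (vectorSpan ℝ F) = k

/-- The point at angle `θ` on the unit circle of the horizontal plane at height `z`. -/
def circlePoint (θ z : ℝ) : E3 := !₂[Real.cos θ, Real.sin θ, z]

/-- The vertices, at height `z`, of the regular `n`-gon inscribed in the unit circle and
rotated by the angle `α`. -/
def gonVertices (n : ℕ) (α z : ℝ) : Set E3 :=
  {x | ∃ k : ℕ, k < n ∧ x = circlePoint (2 * Real.pi * k / n + α) z}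

/-- `F` is a (flat, convex, filled) regular `n`-gon in space. -/
def IsRegularPolygon (n : ℕ) (F : Set E3) : Prop :=
  3 ≤ n ∧ IsSimilar (convexHull ℝ (gonVertices n 0 0)) F

/-- `K` is a right prism over a regular `n`-gon. -/
def IsPrism (n : ℕ) (K : Set E3) : Prop :=
  3 ≤ n ∧ ∃ h : ℝ, 0 < h ∧
    IsSimilar (convexHull ℝ (gonVertices n 0 0 ∪ gonVertices n 0 h)) K

/-- `K` is a right antiprism over a regular `n`-gon: one base is rotated by `π / n`
with respect to the other one. -/
def IsAntiprism (n : ℕ) (K : Set E3) : Prop :=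
  3 ≤ n ∧ ∃ h : ℝ, 0 < h ∧
    IsSimilar (convexHull ℝ (gonVertices n 0 0 ∪ gonVertices n (Real.pi / n) h)) K

/-! ### Platonic and Archimedean solids -/

/-- All points that arise from `(a, b, c)` by a permutation of the coordinates and a choice of
signs belonging to `G`. -/
def signedPerms (G : Set (Equiv.Perm (Fin 3) × (Fin 3 → ℤˣ))) (a b c : ℝ) : Set E3 :=
  {x | ∃ g ∈ G, ∀ i : Fin 3, x i = ((g.2 i : ℤ) : ℝ) * ![a, b, c] (g.1 i)}

/-- All permutations and all signs: the symmetry group of the cube. -/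
def groupOh : Set (Equiv.Perm (Fin 3) × (Fin 3 → ℤˣ)) := univ

/-- The rotation group of the cube. -/
def groupO : Set (Equiv.Perm (Fin 3) × (Fin 3 → ℤˣ)) :=
  {g | Equiv.Perm.sign g.1 = ∏ i, g.2 i}

/-- All permutations, an even number of minus signs: the symmetry group of the tetrahedron. -/
def groupTd : Set (Equiv.Perm (Fin 3) × (Fin 3 → ℤˣ)) :=
  {g | ∏ i, g.2 i = 1}

/-- Even permutations, all signs: the pyritohedral group. -/
def groupTh : Set (Equiv.Perm (Fin 3) × (Fin 3 → ℤˣ)) :=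
  {g | Equiv.Perm.sign g.1 = 1}

/-- Even permutations, an even number of minus signs: the rotation group of the tetrahedron. -/
def groupT : Set (Equiv.Perm (Fin 3) × (Fin 3 → ℤˣ)) :=
  {g | Equiv.Perm.sign g.1 = 1 ∧ ∏ i, g.2 i = 1}

/-- The golden ratio. -/
abbrev φ : ℝ := Real.goldenRatio

/-- The vertex set of the snub cube; `t` is the tribonacci constant. -/
def snubCubeVertices (t : ℝ) : Set E3 := signedPerms groupO 1 (1 / t) t

/-- The vertex set of the snub dodecahedron; `ξ` is the real root of `ξ ^ 3 = 2 * ξ + φ`. -/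
def snubDodecahedronVertices (ξ : ℝ) : Set E3 :=
  let α : ℝ := ξ - 1 / ξ
  let β : ℝ := ξ * φ + φ ^ 2 + φ / ξ
  signedPerms groupT (2 * α) 2 (2 * β) ∪
  signedPerms groupT (α + β / φ + φ) (-α * φ + β + 1 / φ) (α / φ + β * φ - 1) ∪
  signedPerms groupT (α + β / φ - φ) (α * φ - β + 1 / φ) (α / φ + β * φ + 1) ∪
  signedPerms groupT (-α / φ + β * φ + 1) (-α + β / φ - φ) (α * φ + β - 1 / φ) ∪
  signedPerms groupT (-α / φ + β * φ - 1) (α - β / φ - φ) (α * φ + β + 1 / φ)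

/-- The vertex sets, in standard position, of the five Platonic solids: tetrahedron, cube,
octahedron, dodecahedron, icosahedron. -/
def platonicVertexSets : Set (Set E3) :=
  { signedPerms groupTd 1 1 1,
    signedPerms groupOh 1 1 1,
    signedPerms groupOh 1 0 0,
    signedPerms groupTh 1 1 1 ∪ signedPerms groupTh 0 (1 / φ) φ,
    signedPerms groupTh 0 1 φ }

/-- The vertex sets, in standard position, of the thirteen Archimedean solids: truncated
tetrahedron, cuboctahedron, truncated cube, truncated octahedron, rhombicuboctahedron, truncated
cuboctahedron, icosidodecahedron, truncated dodecahedron, truncated icosahedron,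
rhombicosidodecahedron, truncated icosidodecahedron, snub cube, snub dodecahedron. -/
def archimedeanVertexSets : Set (Set E3) :=
  { signedPerms groupTd 3 1 1,
    signedPerms groupOh 1 1 0,
    signedPerms groupOh (√2 - 1) 1 1,
    signedPerms groupOh 0 1 2,
    signedPerms groupOh 1 1 (1 + √2),
    signedPerms groupOh 1 (1 + √2) (1 + 2 * √2),
    signedPerms groupTh (2 * φ) 0 0 ∪ signedPerms groupTh 1 φ (φ ^ 2),
    signedPerms groupTh 0 (1 / φ) (2 + φ) ∪ signedPerms groupTh (1 / φ) φ (2 * φ) ∪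
      signedPerms groupTh φ 2 (φ + 1),
    signedPerms groupTh 0 1 (3 * φ) ∪ signedPerms groupTh 1 (2 + φ) (2 * φ) ∪
      signedPerms groupTh φ 2 (2 * φ + 1),
    signedPerms groupTh 1 1 (φ ^ 3) ∪ signedPerms groupTh (φ ^ 2) φ (2 * φ) ∪
      signedPerms groupTh (2 + φ) 0 (φ ^ 2),
    signedPerms groupTh (1 / φ) (1 / φ) (3 + φ) ∪ signedPerms groupTh (2 / φ) φ (1 + 2 * φ) ∪
      signedPerms groupTh (1 / φ) (φ ^ 2) (3 * φ - 1) ∪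
      signedPerms groupTh (2 * φ - 1) 2 (2 + φ) ∪ signedPerms groupTh φ 3 (2 * φ) } ∪
  {A | ∃ t : ℝ, t ^ 3 = t ^ 2 + t + 1 ∧ A = snubCubeVertices t} ∪
  {A | ∃ ξ : ℝ, ξ ^ 3 = 2 * ξ + φ ∧ A = snubDodecahedronVertices ξ}

/-- `K` is a Platonic or Archimedean solid of any size and position (in the two chiral cases,
of either handedness). -/
def IsPlatonicOrArchimedean (K : Set E3) : Prop :=
  ∃ A ∈ platonicVertexSets ∪ archimedeanVertexSets, IsSimilar (convexHull ℝ A) K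

/-! ### Regular polyhedral surfaces -/

/-- The set `T` of tiles is an edge-to-edge, locally finite tiling of `S` by regular `p`-gons
with exactly `q` of them at each vertex. -/
structure IsRegularTiling (S : Set E3) (T : Set (Set E3)) (p q : ℕ) : Prop where
  polygon : ∀ A ∈ T, IsRegularPolygon p A
  cover : ⋃₀ T = S
  locallyFinite : LocallyFinite (fun A : T => (A : Set E3))
  edge_to_edge : ∀ A ∈ T, ∀ B ∈ T, A ≠ B → (A ∩ B).Nonempty →
    (IsFace 0 A (A ∩ B) ∧ IsFace 0 B (A ∩ B)) ∨ (IsFace 1 A (A ∩ B) ∧ IsFace 1 B (A ∩ B))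
  valency : ∀ x : E3, (∃ A ∈ T, IsFace 0 A {x}) → {A ∈ T | IsFace 0 A {x}}.ncard = q

/-- A subset of space that is a connected topological surface without boundary. -/
def IsSurface (S : Set E3) : Prop :=
  IsConnected S ∧ Nonempty (ChartedSpace (EuclideanSpace ℝ (Fin 2)) S)

/-- `L` is a lattice of rank three. -/
def IsLattice (L : Submodule ℤ E3) : Prop :=
  DiscreteTopology L ∧ Submodule.span ℝ (L : Set E3) = ⊤

/-- The set of orbits of members of `X` under translation by vectors of `L`. -/
def orbits (L : Submodule ℤ E3) (X : Set (Set E3)) : Set (Set (Set E3)) :=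
  (fun A => {B | ∃ v ∈ L, B = (fun x => x + v) '' A}) '' X

/-- The cells of dimension `k` of a tiling: vertices, edges and tiles for `k = 0, 1, 2`. -/
def cells (T : Set (Set E3)) (k : ℕ) : Set (Set E3) :=
  {F | ∃ A ∈ T, IsFace k A F}

/-- The compact quotient by `L` of the surface tiled by `T` has genus `g`, that is, its Euler
characteristic is `2 - 2 * g`. -/
def QuotientHasGenus (L : Submodule ℤ E3) (T : Set (Set E3)) (g : ℕ) : Prop :=
  (∀ k ≤ 2, (orbits L (cells T k)).Finite) ∧
  ((orbits L (cells T 0)).ncard : ℤ) - (orbits L (cells T 1)).ncard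
    + (orbits L (cells T 2)).ncard = 2 - 2 * g

/-! ### Triply periodic skeletal graphs -/

/-- A skeletal graph embedded in space: a simplicial complex of dimension at most one that is
connected as a graph. Its 0-simplices have one element and its 1-simplices two elements. -/
def IsSkeletalGraph (Γ : Geometry.SimplicialComplex ℝ E3) : Prop :=
  (∀ s ∈ Γ.faces, s.card ≤ 2) ∧
  ∀ x ∈ Γ.vertices, ∀ y ∈ Γ.vertices,
    Relation.ReflTransGen (fun a b => ∃ e ∈ Γ.faces, a ∈ e ∧ b ∈ e) x y

/-- The translate of a simplex by a vector. -/
def translate (v : E3) (s : Finset E3) : Finset E3 := s.map (addRightEmbedding v)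

/-- `Γ` is invariant under the translations of `L`. -/
def IsPeriodicGraph (L : Submodule ℤ E3) (Γ : Geometry.SimplicialComplex ℝ E3) : Prop :=
  ∀ v ∈ L, ∀ s ∈ Γ.faces, translate v s ∈ Γ.faces

/-- The simplices of `Γ` with `n` elements, as sets of points. -/
def simplices (Γ : Geometry.SimplicialComplex ℝ E3) (n : ℕ) : Set (Set E3) :=
  {A | ∃ s ∈ Γ.faces, s.card = n ∧ A = (s : Set E3)}

/-- The quotient graph of `Γ` by `L` has genus `g` (number of edges minus number of vertices
plus one), has `v` vertices, and is regular of degree `d`. Loops and multiple edges are allowed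
in the quotient; the degree of a vertex is the one of its preimages in `Γ`. -/
def QuotientGraphHasType (L : Submodule ℤ E3) (Γ : Geometry.SimplicialComplex ℝ E3)
    (g v d : ℕ) : Prop :=
  (orbits L (simplices Γ 1)).Finite ∧ (orbits L (simplices Γ 2)).Finite ∧
  (orbits L (simplices Γ 1)).ncard = v ∧
  ((orbits L (simplices Γ 2)).ncard : ℤ) - v + 1 = g ∧
  ∀ x ∈ Γ.vertices, {e ∈ Γ.faces | e.card = 2 ∧ x ∈ e}.ncard = d

/-! ### Decorations -/

/-- `A` is a deformation retract of `X`. -/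
def IsDeformationRetract (A X : Set E3) : Prop :=
  A ⊆ X ∧ ∃ H : C(unitInterval × X, X),
    (∀ x, H (0, x) = x) ∧ (∀ x, (H (1, x) : E3) ∈ A) ∧
    ∀ t, ∀ x : X, (x : E3) ∈ A → H (t, x) = x

section

variable (Γ : Geometry.SimplicialComplex ℝ E3) (solid : Finset E3 → Set E3)

/-- The polyhedron built from the solids replacing the simplices of `Γ`. -/
def polyhedron : Set E3 := ⋃ s ∈ Γ.faces, solid s

/-- The replacement solids of the simplices `s` and `t` have to be identified along a face:
either one simplex is an end point of the other one and both solids are non-empty, or they are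
the two end points of a 1-simplex that is replaced with the empty solid. -/
def Adjacent (s t : Finset E3) : Prop :=
  s ≠ t ∧ (solid s).Nonempty ∧ (solid t).Nonempty ∧
  (s ⊆ t ∨ t ⊆ s ∨ ∃ e ∈ Γ.faces, solid e = ∅ ∧ s ⊆ e ∧ t ⊆ e)

/-- `solid` is a decoration of the skeletal graph `Γ`: each 0-simplex is replaced with a convex
polyhedron and each 1-simplex with a convex polyhedron or the empty solid, the solids are
identified exactly along common faces of adjacent solids, and the resulting polyhedron
deformation retracts to `Γ`. Solids that are not adjacent meet at most along edges or vertices. -/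
structure IsDecoration : Prop where
  vertex_solid : ∀ s ∈ Γ.faces, s.card = 1 → IsConvexPolyhedron (solid s)
  edge_solid : ∀ s ∈ Γ.faces, s.card = 2 → solid s = ∅ ∨ IsConvexPolyhedron (solid s)
  glued : ∀ s ∈ Γ.faces, ∀ t ∈ Γ.faces, Adjacent Γ solid s t →
    IsFace 2 (solid s) (solid s ∩ solid t) ∧ IsFace 2 (solid t) (solid s ∩ solid t)
  not_glued : ∀ s ∈ Γ.faces, ∀ t ∈ Γ.faces, s ≠ t → ¬ Adjacent Γ solid s t →
    Module.finrank ℝ (vectorSpan ℝ (solid s ∩ solid t)) ≤ 1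
  retract : IsDeformationRetract Γ.space (polyhedron Γ solid)

/-- The faces of the polyhedral surface bounding the polyhedron: the two-dimensional faces of
the solids along which no other solid is attached. -/
def boundaryFaces : Set (Set E3) :=
  {F | ∃ s ∈ Γ.faces, IsFace 2 (solid s) F ∧ ∀ t ∈ Γ.faces, t ≠ s → ¬ IsFace 2 (solid t) F}

/-- The decoration is regular with Schläfli symbol `{p, q | r}`: its boundary is a surface tiled
by regular `p`-gons, `q` at each vertex, and adjacent solids meet in a regular `r`-gon. -/
structure IsRegularDecoration (p q r : ℕ) : Prop extends IsDecoration Γ solid where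
  surface : IsSurface (frontier (polyhedron Γ solid))
  tiling : IsRegularTiling (frontier (polyhedron Γ solid)) (boundaryFaces Γ solid) p q
  polygon : ∀ s ∈ Γ.faces, ∀ t ∈ Γ.faces, Adjacent Γ solid s t →
    IsRegularPolygon r (solid s ∩ solid t)

/-- Only Platonic and Archimedean solids replace the 0-simplices; only prisms and antiprisms over
regular polygons and the empty solid replace the 1-simplices. -/
def IsArchimedean : Prop :=
  (∀ s ∈ Γ.faces, s.card = 1 → IsPlatonicOrArchimedean (solid s)) ∧
  ∀ s ∈ Γ.faces, s.card = 2 →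
    solid s = ∅ ∨ (∃ n, IsPrism n (solid s)) ∨ (∃ n, IsAntiprism n (solid s))

/-- The decoration is invariant under the translations of `L`, so that it is determined by a
decoration of the quotient graph. -/
def IsPeriodicDecoration (L : Submodule ℤ E3) : Prop :=
  ∀ v ∈ L, ∀ s ∈ Γ.faces, solid (translate v s) = (fun x => x + v) '' solid s

end

/-- `S` is a genus `h` regular triply periodic polyhedral surface that is the boundary of a
regular Archimedean decoration of a quotient graph of genus `g` with `v` vertices of degree `d`. -/
def IsRegularDecorationSurface (h g v d : ℕ) (S : Set E3) : Prop :=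
  ∃ (L : Submodule ℤ E3) (Γ : Geometry.SimplicialComplex ℝ E3) (solid : Finset E3 → Set E3)
    (p q r : ℕ),
    IsLattice L ∧ IsSkeletalGraph Γ ∧ IsPeriodicGraph L Γ ∧ QuotientGraphHasType L Γ g v d ∧
    IsPeriodicDecoration Γ solid L ∧ IsArchimedean Γ solid ∧ IsRegularDecoration Γ solid p q r ∧
    S = frontier (polyhedron Γ solid) ∧ QuotientHasGenus L (boundaryFaces Γ solid) h

end RegularDecoration

end

open Set Topology

noncomputable section

namespace RegularDecoration

open Module Submodule

/-! ### Similarities of Euclidean space -/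

/-! The polyhedron is rigid up to finitely many choices. Every two-dimensional face of every solid
lies in the tiling or is a gluing face, so it is a regular `p`-gon or `r`-gon. A regular lateral
face fixes the height of a prism or antiprism relative to its base. The number of sides of the base
is bounded too: `r` is at most the number of vertices of a Platonic or Archimedean solid, and `p ≤
4` because an edge solid has at least three lateral faces, each with at most four vertices, but only
two neighbours to be glued to. Hence up to similarity only finitely many model solids occur
(`exists_model`).

A similarity is determined up to a reflection by its values at three non-collinear points. Gluing
along a face matches three vertices with three vertices, so a model can be attached to a given
polytope in finitely many ways (`finite_placements`). Starting from a vertex solid in standard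
position, a bounded number of gluings reaches finitely many polytopes (`finite_placements_model`).

With at most two orbits of vertices, two equal or adjacent vertices represent all of them
(`exists_representatives`). Connectedness makes the lattice vectors between neighbouring copies of
these representatives sufficient to reach every vertex. Each such vector translates one placed
polytope to another, so it is drawn from a finite set (`finite_placementVectors`). After a
similarity the polyhedron is therefore determined by two subsets of finite sets (`exists_assembly`).
-/

/-- Every similarity of space is a linear isometry followed by a scaling and a translation. -/
theorem exists_similarity_form (g : E3 ≃ᵈ E3) :
    ∃ (r : ℝ) (U : E3 ≃ₗᵢ[ℝ] E3) (t : E3), 0 < r ∧ ∀ x, g x = r • U x + t := by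
  have hr : (0 : ℝ) < Dilation.ratio g := by exact_mod_cast Dilation.ratio_pos g
  set r : ℝ := ((Dilation.ratio g : NNReal) : ℝ)
  have hd : ∀ x y, dist (g x) (g y) = r * dist x y := fun x y => Dilation.dist_eq g x y
  -- Dividing by the ratio and moving the image of the origin back to 0 leaves an isometry that
  -- fixes 0, which is linear by Mazur–Ulam.
  let i : E3 ≃ᵢ E3 :=
    { toFun := fun x => r⁻¹ • (g x - g 0)
      invFun := fun y => g.symm (r • y + g 0)
      left_inv := fun x => by simp [smul_smul, hr.ne']
      right_inv := fun y => by simp [smul_smul, hr.ne']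
      isometry_toFun := Isometry.of_dist_eq fun x y => by
        rw [dist_smul₀, dist_sub_right, hd, Real.norm_of_nonneg (inv_nonneg.2 hr.le),
          inv_mul_cancel_left₀ hr.ne'] }
  have hi : i 0 = 0 := by simp [i]
  refine ⟨r, i.toRealLinearIsometryEquivOfMapZero hi, g 0, hr, fun x => ?_⟩
  simp [i, smul_smul, hr.ne']

/-- A similarity of space as an affine equivalence. -/
theorem exists_affineEquiv (g : E3 ≃ᵈ E3) : ∃ φ : E3 ≃ᵃ[ℝ] E3, ⇑φ = ⇑g := by
  obtain ⟨r, U, t, hr, h⟩ := exists_similarity_form g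
  refine ⟨AffineEquiv.mk g.toEquiv
    (U.toLinearEquiv.trans (LinearEquiv.smulOfNeZero ℝ E3 r hr.ne')) ?_, rfl⟩
  intro p v
  simp [h, add_assoc]

theorem similarity_image_convexHull (g : E3 ≃ᵈ E3) (A : Set E3) :
    g '' convexHull ℝ A = convexHull ℝ (g '' A) := by
  obtain ⟨φ, hφ⟩ := exists_affineEquiv g
  rw [← hφ]
  exact AffineMap.image_convexHull φ.toAffineMap A

theorem similarity_image_extremePoints (g : E3 ≃ᵈ E3) (A : Set E3) :
    g '' extremePoints ℝ A = extremePoints ℝ (g '' A) := by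
  obtain ⟨φ, hφ⟩ := exists_affineEquiv g
  rw [← hφ]
  ext y
  constructor
  · rintro ⟨x, hx, rfl⟩
    refine ⟨mem_image_of_mem _ hx.1, ?_⟩
    rintro _ ⟨a, ha, rfl⟩ _ ⟨b, hb, rfl⟩ hab
    have : x ∈ openSegment ℝ a b := by
      have h := image_openSegment ℝ φ.toAffineMap a b
      simp only [AffineEquiv.coe_toAffineMap] at h
      rw [← h] at hab
      exact (φ.injective.mem_set_image).1 hab
    exact congrArg φ (hx.2 ha hb this)
  · rintro ⟨⟨x, hx, rfl⟩, h⟩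
    refine ⟨x, ⟨hx, fun a ha b hb hab => φ.injective (h (mem_image_of_mem _ ha)
      (mem_image_of_mem _ hb) ?_)⟩, rfl⟩
    have h := image_openSegment ℝ φ.toAffineMap a b
    simp only [AffineEquiv.coe_toAffineMap] at h
    rw [← h]
    exact mem_image_of_mem _ hab

theorem finrank_vectorSpan_similarity_image (g : E3 ≃ᵈ E3) (A : Set E3) :
    finrank ℝ (vectorSpan ℝ (g '' A)) = finrank ℝ (vectorSpan ℝ A) := by
  obtain ⟨φ, hφ⟩ := exists_affineEquiv g
  rw [← hφ]
  have h := AffineMap.map_vectorSpan φ.toAffineMap (s := A)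
  simp only [AffineEquiv.coe_toAffineMap] at h
  rw [← h]
  exact LinearEquiv.finrank_map_eq φ.linear _

theorem IsExposed.similarity_image (g : E3 ≃ᵈ E3) {K F : Set E3} (h : IsExposed ℝ K F) :
    IsExposed ℝ (g '' K) (g '' F) := by
  intro hne
  obtain ⟨l, hl⟩ := h (by simpa using hne)
  obtain ⟨r, U, t, hr, hg⟩ := exists_similarity_form g
  -- Pulled back along `g`, this functional is `l` up to a positive factor and a constant, so
  -- maximizers correspond.
  let l' : StrongDual ℝ E3 := l.comp (U.symm.toContinuousLinearEquiv : E3 →L[ℝ] E3)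
  have key : ∀ x, l' (g x) = r * l x + l' t := fun x => by simp [l', hg]
  refine ⟨l', ?_⟩
  ext y
  constructor
  · rintro ⟨x, hx, rfl⟩
    rw [hl] at hx
    refine ⟨mem_image_of_mem _ hx.1, ?_⟩
    rintro _ ⟨z, hz, rfl⟩
    rw [key, key]
    have := mul_le_mul_of_nonneg_left (hx.2 z hz) hr.le
    linarith
  · rintro ⟨⟨x, hx, rfl⟩, hy⟩
    refine mem_image_of_mem _ ?_
    rw [hl]
    refine ⟨hx, fun z hz => ?_⟩
    have := hy (g z) (mem_image_of_mem _ hz)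
    rw [key, key] at this
    exact le_of_mul_le_mul_left (by linarith) hr

theorem IsFace.similarity_image (g : E3 ≃ᵈ E3) {k : ℕ} {K F : Set E3} (h : IsFace k K F) :
    IsFace k (g '' K) (g '' F) :=
  ⟨h.1.image _, IsExposed.similarity_image g h.2.1,
    (finrank_vectorSpan_similarity_image g F).trans h.2.2⟩

theorem IsSimilar.symm {A B : Set E3} (h : IsSimilar A B) : IsSimilar B A := by
  obtain ⟨f, rfl⟩ := h
  exact ⟨f.symm, by rw [← image_comp]; simp⟩

theorem IsSimilar.trans {A B C : Set E3} (h : IsSimilar A B) (h' : IsSimilar B C) :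
    IsSimilar A C := by
  obtain ⟨f, rfl⟩ := h
  obtain ⟨g, rfl⟩ := h'
  exact ⟨f.trans g, by rw [← image_comp]; rfl⟩

/-! ### Faces of polytopes -/

theorem finrank_E3 : finrank ℝ E3 = 3 := by simp

theorem vectorSpan_convexHull (A : Set E3) : vectorSpan ℝ (convexHull ℝ A) = vectorSpan ℝ A := by
  rw [← direction_affineSpan, affineSpan_convexHull, direction_affineSpan]

/-- The points of a polytope at which a linear functional attains its maximum `M` over the
vertices form the hull of the vertices at which it does. -/
theorem convexHull_inter_level (A : Set E3) (l : E3 →ₗ[ℝ] ℝ) (M : ℝ) (hM : ∀ a ∈ A, l a ≤ M) :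
    {x ∈ convexHull ℝ A | l x = M} = convexHull ℝ {a ∈ A | l a = M} := by
  apply Subset.antisymm
  · rintro x ⟨hx, hxM⟩
    rw [convexHull_eq] at hx
    obtain ⟨ι, t, w, z, hw, hw1, hz, rfl⟩ := hx
    -- A vanishing weighted sum of non-negative gaps forces a zero gap wherever the weight is
    -- non-zero; the other points are dropped from the combination.
    have hl : ∑ i ∈ t, w i * (M - l (z i)) = 0 := by
      rw [Finset.centerMass_eq_of_sum_1 _ _ hw1, map_sum] at hxM
      simp only [map_smul, smul_eq_mul] at hxM
      simp only [mul_sub, Finset.sum_sub_distrib, ← Finset.sum_mul, hw1, hxM]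
      ring
    have h0 := (Finset.sum_eq_zero_iff_of_nonneg (fun i hi =>
      mul_nonneg (hw i hi) (sub_nonneg.2 (hM _ (hz i hi))))).1 hl
    rw [← Finset.centerMass_filter_ne_zero]
    refine Finset.centerMass_mem_convexHull _ (fun i hi => hw i (Finset.mem_filter.1 hi).1) ?_ ?_
    · rw [Finset.sum_filter_ne_zero, hw1]; exact one_pos
    · intro i hi
      obtain ⟨hi, hne⟩ := Finset.mem_filter.1 hi
      refine ⟨hz i hi, ?_⟩
      have := (mul_eq_zero.1 (h0 i hi)).resolve_left hne
      linarith
  · refine convexHull_min (fun a ha => ⟨subset_convexHull ℝ _ ha.1, ha.2⟩) ?_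
    exact (convex_convexHull ℝ A).inter ((convex_singleton M).linear_preimage l)

/-- An exposed face of the hull of `A` is the hull of the points of `A` on it. -/
theorem IsExposed.eq_convexHull {A F : Set E3} (h : IsExposed ℝ (convexHull ℝ A) F)
    (hne : F.Nonempty) : F = convexHull ℝ (A ∩ F) := by
  obtain ⟨l, hl⟩ := h hne
  obtain ⟨x, hx⟩ := hne
  have hx' := hl ▸ hx
  have hM : ∀ a ∈ A, l a ≤ l x := fun a ha => hx'.2 a (subset_convexHull ℝ _ ha)
  have hF : F = {y ∈ convexHull ℝ A | (l : E3 →ₗ[ℝ] ℝ) y = l x} := by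
    ext y
    constructor
    · intro hy
      have hy' := hl ▸ hy
      exact ⟨hy'.1, le_antisymm (hx'.2 y hy'.1) (hy'.2 x hx'.1)⟩
    · rintro ⟨hy, hyx⟩
      rw [hl]
      refine ⟨hy, fun z hz => ?_⟩
      have : l y = l x := hyx
      rw [this]
      exact hx'.2 z hz
  have h2 := convexHull_inter_level A l (l x) hM
  rw [← hF] at h2
  nth_rewrite 1 [h2]
  congr 1
  ext a
  constructor
  · rintro ⟨ha, hax⟩
    exact ⟨ha, by rw [hF]; exact ⟨subset_convexHull ℝ _ ha, hax⟩⟩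
  · rintro ⟨ha, haF⟩
    rw [hF] at haF
    exact ⟨ha, haF.2⟩

theorem IsFace.subset {k : ℕ} {K F : Set E3} (h : IsFace k K F) : F ⊆ K := h.2.1.subset

/-- This is the source of finiteness: the vertices of a face can only be chosen in the finite set
`A`. -/
theorem IsFace.extremePoints_subset {k : ℕ} {A F : Set E3} (h : IsFace k (convexHull ℝ A) F) :
    extremePoints ℝ F ⊆ A := by
  have := IsExposed.eq_convexHull h.2.1 h.1
  rw [this]
  exact extremePoints_convexHull_subset.trans inter_subset_left

theorem convexHull_extremePoints_convexHull {A : Set E3} (hA : A.Finite) :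
    convexHull ℝ (extremePoints ℝ (convexHull ℝ A)) = convexHull ℝ A := by
  have h := closure_convexHull_extremePoints (Set.Finite.isCompact_convexHull ℝ hA)
    (convex_convexHull ℝ A)
  have hf : (extremePoints ℝ (convexHull ℝ A)).Finite :=
    hA.subset extremePoints_convexHull_subset
  rwa [(Set.Finite.isClosed_convexHull ℝ hf).closure_eq] at h

/-- Two faces of the same dimension, one of them contained in the other one, coincide. -/
theorem IsFace.eq_of_subset {k : ℕ} {K F G : Set E3} (hF : IsFace k K F) (hG : IsFace k K G)
    (h : F ⊆ G) : F = G := by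
  refine h.antisymm fun y hy => ?_
  obtain ⟨l, hl⟩ := hF.2.1 hF.1
  -- Equal dimensions force equal directions, so the functional exposing `F` is constant on `G` as
  -- well.
  have hspan : vectorSpan ℝ F = vectorSpan ℝ G :=
    Submodule.eq_of_le_of_finrank_eq (vectorSpan_mono ℝ h) (hF.2.2.trans hG.2.2.symm)
  obtain ⟨x, hx⟩ := hF.1
  have hker : vectorSpan ℝ F ≤ LinearMap.ker (l : E3 →ₗ[ℝ] ℝ) := by
    rw [vectorSpan_def, Submodule.span_le]
    rintro _ ⟨a, ha, b, hb, rfl⟩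
    have ha' := hl ▸ ha
    have hb' := hl ▸ hb
    simp only [vsub_eq_sub, SetLike.mem_coe, LinearMap.mem_ker, map_sub]
    exact sub_eq_zero.2 (le_antisymm (hb'.2 a ha'.1) (ha'.2 b hb'.1))
  have hyx : y - x ∈ vectorSpan ℝ F := hspan ▸ vsub_mem_vectorSpan ℝ hy (h hx)
  have h0 : l (y - x) = 0 := hker hyx
  have hlyx : l y = l x := by rw [map_sub] at h0; linarith
  have hx' := hl ▸ hx
  rw [hl]
  exact ⟨hG.subset hy, fun z hz => hlyx ▸ hx'.2 z hz⟩

/-- A criterion for a set of vertices to span a two-dimensional face. -/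
theorem isFace_two_convexHull {A B : Set E3} (l : StrongDual ℝ E3) (hl : l ≠ 0) (M : ℝ)
    (hM : ∀ a ∈ A, l a ≤ M) (hB : B = {a ∈ A | l a = M}) {p : Fin 3 → E3}
    (hp : AffineIndependent ℝ p) (hpB : ∀ i, p i ∈ B) :
    IsFace 2 (convexHull ℝ A) (convexHull ℝ B) := by
  have h := convexHull_inter_level A (l : E3 →ₗ[ℝ] ℝ) M hM
  simp only [ContinuousLinearMap.coe_coe] at h
  rw [← hB] at h
  have hle : ∀ y ∈ convexHull ℝ A, l y ≤ M := fun y hy =>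
    (convexHull_min (t := {y | l y ≤ M}) hM
      ((convex_Iic M).linear_preimage (l : E3 →ₗ[ℝ] ℝ))) hy
  have hne : (convexHull ℝ B).Nonempty := ⟨p 0, subset_convexHull ℝ _ (hpB 0)⟩
  refine ⟨hne, fun _ => ⟨l, ?_⟩, ?_⟩
  · rw [← h]
    obtain ⟨z, hz⟩ := hne
    rw [← h] at hz
    ext x
    constructor
    · rintro ⟨hx, hxM⟩
      exact ⟨hx, fun y hy => hxM.symm ▸ hle y hy⟩
    · rintro ⟨hx, hx2⟩
      exact ⟨hx, le_antisymm (hle x hx) (hz.2 ▸ hx2 z hz.1)⟩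
  · rw [vectorSpan_convexHull]
    apply le_antisymm
    · have hker : vectorSpan ℝ B ≤ LinearMap.ker (l : E3 →ₗ[ℝ] ℝ) := by
        rw [vectorSpan_def, Submodule.span_le]
        rintro _ ⟨a, ha, b, hb, rfl⟩
        rw [hB] at ha hb
        simp [ha.2, hb.2]
      refine (Submodule.finrank_mono hker).trans ?_
      have hlt : finrank ℝ (LinearMap.ker (l : E3 →ₗ[ℝ] ℝ)) < finrank ℝ E3 := by
        apply Submodule.finrank_lt
        intro htop
        apply hl
        ext x
        have : x ∈ LinearMap.ker (l : E3 →ₗ[ℝ] ℝ) := htop ▸ Submodule.mem_top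
        exact this
      rw [finrank_E3] at hlt
      omega
    · rw [← hp.finrank_vectorSpan (n := 2) (by simp)]
      exact Submodule.finrank_mono (vectorSpan_mono ℝ (range_subset_iff.2 hpB))

/-! ### Finiteness of placements -/

/-- A linear isometry of space that fixes a plane pointwise is the identity or the reflection. -/
theorem linearIsometry_eq_of_fixes_plane (W : Submodule ℝ E3) (hW : finrank ℝ W = 2)
    (U : E3 ≃ₗᵢ[ℝ] E3) (hU : ∀ w ∈ W, U w = w) :
    (∀ x, U x = x) ∨ ∀ x, U x = W.reflection x := by
  have hperp : finrank ℝ Wᗮ = 1 := by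
    have := W.finrank_add_finrank_orthogonal
    rw [hW, finrank_E3] at this
    omega
  obtain ⟨⟨w, hwW⟩, hw0, hw⟩ := finrank_eq_one_iff'.1 hperp
  have hw0' : w ≠ 0 := fun h => hw0 (by simpa using h)
  -- The normal line of the plane is preserved, and an isometry acts on a line by 1 or -1.
  have hUw : U w ∈ Wᗮ := by
    rw [Submodule.mem_orthogonal]
    intro u hu
    rw [← hU u hu, U.inner_map_map]
    exact (Submodule.mem_orthogonal W w).1 hwW u hu
  obtain ⟨c, hc⟩ := hw ⟨U w, hUw⟩
  have hc' : c • w = U w := congrArg Subtype.val hc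
  have habs : |c| = 1 := by
    have h1 : ‖c • w‖ = ‖w‖ := by rw [hc', U.norm_map]
    rw [norm_smul, Real.norm_eq_abs] at h1
    exact mul_right_cancel₀ (norm_ne_zero_iff.2 hw0') (h1.trans (one_mul _).symm)
  have hdec : ∀ x : E3, ∃ a ∈ W, ∃ d : ℝ, x = a + d • w := by
    intro x
    obtain ⟨a, ha, b, hb, rfl⟩ := W.exists_add_mem_mem_orthogonal x
    obtain ⟨d, hd⟩ := hw ⟨b, hb⟩
    have hd' : d • w = b := congrArg Subtype.val hd
    exact ⟨a, ha, d, by rw [hd']⟩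
  rcases (abs_eq one_pos.le).1 habs with rfl | rfl
  · left
    intro x
    obtain ⟨a, ha, d, rfl⟩ := hdec x
    rw [map_add, map_smul, hU a ha, ← hc', one_smul]
  · right
    intro x
    obtain ⟨a, ha, d, rfl⟩ := hdec x
    rw [map_add, map_smul, hU a ha, ← hc', map_add, map_smul,
      Submodule.reflection_mem_subspace_eq_self ha,
      Submodule.reflection_mem_subspace_orthogonalComplement_eq_neg hwW]
    simp

/-- There are at most two similarities with prescribed values at three points in general
position. -/
theorem finite_similarities_of_three_points (b a : Fin 3 → E3) (hb : AffineIndependent ℝ b) :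
    {g : E3 ≃ᵈ E3 | ∀ i, g (b i) = a i}.Finite := by
  by_cases hex : ∃ g₀ : E3 ≃ᵈ E3, ∀ i, g₀ (b i) = a i
  swap
  · refine Set.finite_empty.subset fun g hg => hex ⟨g, hg⟩
  obtain ⟨g₀, hg₀⟩ := hex
  set W := vectorSpan ℝ (range b)
  have hW : finrank ℝ W = 2 := hb.finrank_vectorSpan (by simp)
  have hinj : Function.Injective (DFunLike.coe : (E3 ≃ᵈ E3) → E3 → E3) := DFunLike.coe_injective
  refine Set.Finite.of_finite_image (f := DFunLike.coe) (Set.Finite.subset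
    (Set.toFinite {⇑g₀, fun x => g₀ (W.reflection (x - b 0) + b 0)}) ?_) hinj.injOn
  rintro _ ⟨g, hg, rfl⟩
  -- Comparison with one solution `g₀`: the composite fixes the three points, so its linear part
  -- fixes `W` pointwise, which forces ratio 1.
  obtain ⟨r, U, t, hr, hu⟩ := exists_similarity_form (g.trans g₀.symm)
  have hfix : ∀ i, r • U (b i) + t = b i := fun i => by
    rw [← hu]
    change g₀.symm (g (b i)) = b i
    rw [hg i, ← hg₀ i, g₀.symm_apply_apply]
  have hdiff : ∀ w ∈ W, r • U w = w := by
    intro w hw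
    induction hw using Submodule.span_induction with
    | mem x hx =>
      obtain ⟨_, ⟨i, rfl⟩, _, ⟨j, rfl⟩, rfl⟩ := hx
      simp only [vsub_eq_sub, map_sub, smul_sub]
      rw [eq_sub_of_add_eq (hfix i), eq_sub_of_add_eq (hfix j)]
      abel
    | zero => simp
    | add x y _ _ hx hy => rw [map_add, smul_add, hx, hy]
    | smul c x _ hx => rw [map_smul, smul_comm, hx]
  have hr1 : r = 1 := by
    have h01 : b 1 - b 0 ≠ 0 := sub_ne_zero.2 (hb.injective.ne (by decide))
    have hmem : b 1 - b 0 ∈ W := vsub_mem_vectorSpan ℝ (mem_range_self _) (mem_range_self _)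
    have h1 := congrArg norm (hdiff _ hmem)
    rw [norm_smul, U.norm_map, Real.norm_of_nonneg hr.le] at h1
    exact mul_right_cancel₀ (norm_ne_zero_iff.2 h01) (h1.trans (one_mul _).symm)
  subst hr1
  simp only [one_smul] at hdiff hfix hu
  have hgx : ∀ x, g x = g₀ (U (x - b 0) + b 0) := by
    intro x
    have h1 : g₀.symm (g x) = U x + t := hu x
    have h2 : U (x - b 0) + b 0 = U x + t := by
      rw [map_sub, eq_sub_of_add_eq (hfix 0)]
      abel
    rw [h2, ← h1, g₀.apply_symm_apply]
  rcases linearIsometry_eq_of_fixes_plane W hW U hdiff with h | h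
  · left
    funext x
    rw [hgx, h, sub_add_cancel]
  · right
    funext x
    rw [hgx, h]

theorem exists_affineIndependent_three {X : Set E3} (hX : finrank ℝ (vectorSpan ℝ X) = 2) :
    ∃ p : Fin 3 → E3, AffineIndependent ℝ p ∧ ∀ i, p i ∈ X := by
  obtain ⟨t, htX, hspan, hind⟩ := exists_affineIndependent ℝ E3 X
  have hfin : t.Finite := finite_set_of_fin_dim_affineIndependent ℝ hind
  have := hfin.fintype
  have hv : finrank ℝ (vectorSpan ℝ t) = 2 := by
    rw [← direction_affineSpan, hspan, direction_affineSpan, hX]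
  have hne : Nonempty t := by
    by_contra h
    have ht : t = ∅ := isEmpty_coe_sort.1 (not_nonempty_iff.1 h)
    rw [ht, vectorSpan_empty, finrank_bot] at hv
    omega
  have hcard := hind.finrank_vectorSpan_add_one
  rw [show range (fun x : t => (x : E3)) = t from Subtype.range_coe, hv] at hcard
  let e := (Fintype.equivFinOfCardEq hcard.symm).symm
  exact ⟨fun i => e i, hind.comp_embedding e.toEmbedding, fun i => htX (e i).2⟩

/-- A copy of a polytope can be attached to a given polytope along a common face in finitely
many ways only. -/
theorem finite_placements {A B : Set E3} (hA : A.Finite) (hB : B.Finite) :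
    {K : Set E3 | IsSimilar (convexHull ℝ B) K ∧
      IsFace 2 (convexHull ℝ A) (convexHull ℝ A ∩ K) ∧
      IsFace 2 K (convexHull ℝ A ∩ K)}.Finite := by
  have hfinA : {p : Fin 3 → E3 | ∀ i, p i ∈ A}.Finite := Set.Finite.pi' fun _ => hA
  have hfinB : {p : Fin 3 → E3 | ∀ i, p i ∈ B}.Finite := Set.Finite.pi' fun _ => hB
  have hU : (⋃ a ∈ {p : Fin 3 → E3 | ∀ i, p i ∈ A},
      ⋃ b ∈ {b : Fin 3 → E3 | (∀ i, b i ∈ B)},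
        {g : E3 ≃ᵈ E3 | AffineIndependent ℝ b ∧ ∀ i, g (b i) = a i}).Finite := by
    refine hfinA.biUnion fun a _ => hfinB.biUnion fun b _ => ?_
    by_cases hb : AffineIndependent ℝ b
    · exact (finite_similarities_of_three_points b a hb).subset fun g hg => hg.2
    · exact Set.finite_empty.subset fun g hg => hb hg.1
  refine (hU.image fun g : E3 ≃ᵈ E3 => g '' convexHull ℝ B).subset ?_
  rintro _ ⟨⟨g, rfl⟩, h1, h2⟩
  -- The vertices of the common face lie both in `A` and in `g '' B`. Three independent ones exhibit
  -- `g` as a similarity carrying a triple from `B` to a triple from `A`.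
  set F := convexHull ℝ A ∩ g '' convexHull ℝ B
  have hEA : extremePoints ℝ F ⊆ A := h1.extremePoints_subset
  have hEB : extremePoints ℝ F ⊆ g '' B := by
    rw [similarity_image_convexHull] at h2
    exact h2.extremePoints_subset
  have hF : convexHull ℝ (extremePoints ℝ F) = F := by
    have := IsExposed.eq_convexHull h1.2.1 h1.1
    rw [this]
    exact convexHull_extremePoints_convexHull (hA.subset inter_subset_left)
  have hrank : finrank ℝ (vectorSpan ℝ (extremePoints ℝ F)) = 2 := by
    rw [← vectorSpan_convexHull, hF]
    exact h1.2.2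
  obtain ⟨p, hp, hpX⟩ := exists_affineIndependent_three hrank
  choose b hb hgb using fun i => hEB (hpX i)
  refine mem_image_of_mem _ ?_
  simp only [mem_iUnion, mem_ofPred_eq]
  refine ⟨p, fun i => hEA (hpX i), b, hb, ?_, hgb⟩
  obtain ⟨φ, hφ⟩ := exists_affineEquiv g
  have : p = φ ∘ b := by
    funext i
    rw [Function.comp_apply, hφ, hgb]
  rw [this] at hp
  exact (AffineEquiv.affineIndependent_iff φ).1 hp

/-! ### Regular polygons -/

/-- The vertices of a regular polygon, indexed cyclically by the integers. -/
def gonPoint (n : ℕ) (α z : ℝ) (j : ℤ) : E3 := circlePoint (2 * Real.pi * j / n + α) z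

theorem gonPoint_eq_of_dvd {n : ℕ} (hn : n ≠ 0) (α z : ℝ) {j k : ℤ} (h : (n : ℤ) ∣ j - k) :
    gonPoint n α z j = gonPoint n α z k := by
  obtain ⟨m, hm⟩ := h
  have hn' : (n : ℝ) ≠ 0 := by exact_mod_cast hn
  have hj : (j : ℝ) = k + n * m := by
    have : j = k + n * m := by linarith
    rw [this]; push_cast; ring
  have : 2 * Real.pi * j / n + α = 2 * Real.pi * k / n + α + m * (2 * Real.pi) := by
    rw [hj]; field_simp; ring
  rw [gonPoint, gonPoint, circlePoint, circlePoint, this, Real.cos_add_int_mul_two_pi,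
    Real.sin_add_int_mul_two_pi]

theorem gonVertices_eq_range {n : ℕ} (hn : n ≠ 0) (α z : ℝ) :
    gonVertices n α z = range (gonPoint n α z) := by
  ext x
  constructor
  · rintro ⟨k, _, rfl⟩
    exact ⟨k, by simp [gonPoint]⟩
  · rintro ⟨j, rfl⟩
    have hn' : (n : ℤ) ≠ 0 := by exact_mod_cast hn
    have h0 := Int.emod_nonneg j hn'
    have h1 := Int.emod_lt_of_pos j (by omega : (0 : ℤ) < n)
    refine ⟨(j % n).toNat, by omega, ?_⟩
    have h2 : (((j % n).toNat : ℕ) : ℤ) = j % n := Int.toNat_of_nonneg h0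
    have h3 : (((j % n).toNat : ℕ) : ℝ) = ((j % n : ℤ) : ℝ) := by exact_mod_cast h2
    rw [h3]
    exact gonPoint_eq_of_dvd hn α z (Int.dvd_self_sub_emod)

theorem finite_gonVertices (n : ℕ) (α z : ℝ) : (gonVertices n α z).Finite := by
  refine ((finite_lt_nat n).image
    fun k : ℕ => circlePoint (2 * Real.pi * k / n + α) z).subset ?_
  rintro _ ⟨k, hk, rfl⟩
  exact ⟨k, hk, rfl⟩

theorem circlePoint_apply (θ z : ℝ) : circlePoint θ z 0 = Real.cos θ ∧
    circlePoint θ z 1 = Real.sin θ ∧ circlePoint θ z 2 = z := by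
  simp [circlePoint]

theorem dist_circlePoint_sq (θ η z w : ℝ) :
    dist (circlePoint θ z) (circlePoint η w) ^ 2 = 2 - 2 * Real.cos (θ - η) + (z - w) ^ 2 := by
  rw [EuclideanSpace.dist_eq, Real.sq_sqrt (Finset.sum_nonneg fun _ _ => sq_nonneg _)]
  simp only [Fin.sum_univ_three, Real.dist_eq, sq_abs, circlePoint_apply, Real.cos_sub]
  nlinarith [Real.sin_sq_add_cos_sq θ, Real.sin_sq_add_cos_sq η]

theorem dist_gonPoint_sq (n : ℕ) (α β z w : ℝ) (j k : ℤ) :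
    dist (gonPoint n α z j) (gonPoint n β w k) ^ 2 =
      2 - 2 * Real.cos (2 * Real.pi * (j - k : ℤ) / n + (α - β)) + (z - w) ^ 2 := by
  rw [gonPoint, gonPoint, dist_circlePoint_sq]
  congr 4
  push_cast
  ring

theorem cos_two_pi_mul_div_eq_one {n : ℕ} (hn : n ≠ 0) (j : ℤ) :
    Real.cos (2 * Real.pi * j / n) = 1 ↔ (n : ℤ) ∣ j := by
  have hn' : (n : ℝ) ≠ 0 := by exact_mod_cast hn
  rw [Real.cos_eq_one_iff]
  constructor
  · rintro ⟨m, hm⟩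
    refine ⟨m, ?_⟩
    field_simp at hm
    have : (j : ℝ) = n * m := by linarith
    exact_mod_cast this
  · rintro ⟨m, rfl⟩
    refine ⟨m, ?_⟩
    push_cast
    field_simp

theorem gonPoint_eq_iff {n : ℕ} (hn : n ≠ 0) (α z : ℝ) {j k : ℤ} :
    gonPoint n α z j = gonPoint n α z k ↔ (n : ℤ) ∣ j - k := by
  refine ⟨fun h => ?_, gonPoint_eq_of_dvd hn α z⟩
  have := dist_gonPoint_sq n α α z z j k
  rw [h, dist_self] at this
  rw [← cos_two_pi_mul_div_eq_one hn]
  simp only [sub_self, add_zero] at this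
  linarith

theorem ncard_gonVertices (n : ℕ) (hn : n ≠ 0) (α z : ℝ) : (gonVertices n α z).ncard = n := by
  have : gonVertices n α z = (fun k : ℕ => gonPoint n α z k) '' (Finset.range n : Set ℕ) := by
    ext x
    constructor
    · rintro ⟨k, hk, rfl⟩
      exact ⟨k, by simpa using hk, by simp [gonPoint]⟩
    · rintro ⟨k, hk, rfl⟩
      exact ⟨k, by simpa using hk, by simp [gonPoint]⟩
  rw [this, InjOn.ncard_image, ncard_coe_finset, Finset.card_range]
  intro j hj k hk h
  have hj' : j < n := by simpa using hj
  have hk' : k < n := by simpa using hk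
  have hd := (gonPoint_eq_iff hn α z).1 h
  have := Int.eq_zero_of_abs_lt_dvd hd (by rw [abs_lt]; omega)
  omega

theorem norm_gonPoint_zero (n : ℕ) (α : ℝ) (j : ℤ) : ‖gonPoint n α 0 j‖ = 1 := by
  rw [EuclideanSpace.norm_eq]
  simp [Fin.sum_univ_three, gonPoint, circlePoint]

/-- Points on the unit sphere are in convex position. -/
theorem extremePoints_convexHull_of_norm_eq_one {A : Set E3} (hA : ∀ a ∈ A, ‖a‖ = 1) :
    extremePoints ℝ (convexHull ℝ A) = A := by
  apply extremePoints_convexHull_subset.antisymm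
  intro a ha
  have hsub : convexHull ℝ A ⊆ Metric.closedBall 0 1 :=
    convexHull_min (fun x hx => by simp [hA x hx]) (convex_closedBall 0 1)
  refine ⟨subset_convexHull ℝ _ ha, fun x hx y hy hxy => ?_⟩
  by_contra hne
  have hxy' : x ≠ y := by
    rintro rfl
    rw [openSegment_same] at hxy
    exact hne hxy.symm
  have := openSegment_subset_ball_of_ne (hsub hx) (hsub hy) hxy' hxy
  rw [mem_ball_zero_iff, hA a ha] at this
  exact lt_irrefl _ this

theorem extremePoints_gon (n : ℕ) (hn : n ≠ 0) :
    extremePoints ℝ (convexHull ℝ (gonVertices n 0 0)) = gonVertices n 0 0 := by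
  refine extremePoints_convexHull_of_norm_eq_one fun a ha => ?_
  rw [gonVertices_eq_range hn] at ha
  obtain ⟨j, rfl⟩ := ha
  exact norm_gonPoint_zero n 0 j

/-- The number of sides is thus an invariant of the set, which later allows `n` to be identified
with `p` or `r`. -/
theorem IsRegularPolygon.ncard_extremePoints {n : ℕ} {F : Set E3} (h : IsRegularPolygon n F) :
    (extremePoints ℝ F).ncard = n := by
  obtain ⟨hn, f, rfl⟩ := h
  rw [← similarity_image_extremePoints, ncard_image_of_injective _ f.injective,
    extremePoints_gon n (by omega), ncard_gonVertices n (by omega)]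

theorem IsRegularPolygon.of_image (g : E3 ≃ᵈ E3) {n : ℕ} {F : Set E3}
    (h : IsRegularPolygon n (g '' F)) : IsRegularPolygon n F :=
  ⟨h.1, h.2.trans (IsSimilar.symm ⟨g, rfl⟩)⟩

theorem IsRegularPolygon.image (g : E3 ≃ᵈ E3) {n : ℕ} {F : Set E3}
    (h : IsRegularPolygon n F) : IsRegularPolygon n (g '' F) :=
  ⟨h.1, h.2.trans ⟨g, rfl⟩⟩

theorem IsRegularPolygon.le_ncard {n : ℕ} {F X : Set E3} (h : IsRegularPolygon n F)
    (hX : X.Finite) (hF : extremePoints ℝ F ⊆ X) : n ≤ X.ncard :=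
  h.ncard_extremePoints ▸ ncard_le_ncard hF hX

/-- Three consecutive vertices of a regular polygon. -/
theorem IsRegularPolygon.exists_three {n : ℕ} {F : Set E3} (h : IsRegularPolygon n F) :
    ∃ a ∈ extremePoints ℝ F, ∃ b ∈ extremePoints ℝ F, ∃ c ∈ extremePoints ℝ F,
      a ≠ b ∧ a ≠ c ∧ b ≠ c ∧ dist a b = dist b c ∧ (n = 3 → dist a b = dist a c) := by
  obtain ⟨hn, f, rfl⟩ := h
  have hn0 : n ≠ 0 := by omega
  rw [← similarity_image_extremePoints, extremePoints_gon n hn0, gonVertices_eq_range hn0]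
  have hne : ∀ j k : ℤ, |j - k| < n → j ≠ k → f (gonPoint n 0 0 j) ≠ f (gonPoint n 0 0 k) := by
    intro j k hjk hne heq
    have := Int.eq_zero_of_abs_lt_dvd ((gonPoint_eq_iff hn0 0 0).1 (f.injective heq)) hjk
    omega
  have hdist : ∀ j k l m : ℤ, Real.cos (2 * Real.pi * (j - k : ℤ) / n) =
      Real.cos (2 * Real.pi * (l - m : ℤ) / n) →
      dist (f (gonPoint n 0 0 j)) (f (gonPoint n 0 0 k)) =
        dist (f (gonPoint n 0 0 l)) (f (gonPoint n 0 0 m)) := by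
    intro j k l m hc
    rw [Dilation.dist_eq, Dilation.dist_eq]
    congr 1
    rw [← sq_eq_sq₀ dist_nonneg dist_nonneg, dist_gonPoint_sq, dist_gonPoint_sq]
    simp only [sub_self, add_zero]
    rw [hc]
  -- The vertices with indices 0, 1, 2 are distinct since `3 ≤ n`; in a triangle the indices 0 and 2
  -- are neighbours as well.
  refine ⟨_, mem_image_of_mem _ (mem_range_self 0), _, mem_image_of_mem _ (mem_range_self 1), _,
    mem_image_of_mem _ (mem_range_self 2), hne _ _ ?_ ?_, hne _ _ ?_ ?_, hne _ _ ?_ ?_,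
    hdist _ _ _ _ (by norm_num), ?tri⟩
  case tri =>
    rintro rfl
    apply hdist
    have h1 : 2 * Real.pi * ((0 - 1 : ℤ) : ℝ) / ((3 : ℕ) : ℝ) = -(2 * Real.pi / 3) := by
      push_cast; ring
    have h2 : 2 * Real.pi * ((0 - 2 : ℤ) : ℝ) / ((3 : ℕ) : ℝ) = 2 * Real.pi / 3 - 2 * Real.pi := by
      push_cast; ring
    rw [h1, h2, Real.cos_neg, Real.cos_sub_two_pi]
  all_goals norm_num
  all_goals omega

/-! ### Faces of prisms and antiprisms -/

theorem cos_mul_pi_div_le {n a : ℕ} (ha : 1 ≤ a) (han : a ≤ n) :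
    Real.cos (a * Real.pi / n) ≤ Real.cos (Real.pi / n) ∧
      (Real.cos (a * Real.pi / n) = Real.cos (Real.pi / n) → a = 1) := by
  have hn : (0 : ℝ) < n := by exact_mod_cast (by omega : 0 < n)
  have ha' : (1 : ℝ) ≤ a := by exact_mod_cast ha
  have han' : (a : ℝ) ≤ n := by exact_mod_cast han
  have h1 : Real.pi / n ∈ Icc 0 Real.pi := by
    refine ⟨by positivity, (div_le_iff₀ hn).2 ?_⟩
    nlinarith [Real.pi_pos]
  have h2 : a * Real.pi / n ∈ Icc 0 Real.pi := by
    refine ⟨by positivity, (div_le_iff₀ hn).2 ?_⟩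
    nlinarith [Real.pi_pos]
  constructor
  · refine Real.strictAntiOn_cos.antitoneOn h1 h2 ?_
    gcongr
    nlinarith [Real.pi_pos]
  · intro h
    have := Real.injOn_cos h2 h1 h
    field_simp at this
    exact_mod_cast this

/-- Reduction modulo `2 * n` and the symmetry of cosine bring `m` into the range from 1 to `n`,
where cosine decreases; oddness excludes 0. The odd multiples of `π / n` are the angles between the
normal of a side and the vertices of the polygon. -/
theorem cos_odd_mul_pi_div_le {n : ℕ} (hn : n ≠ 0) (m : ℤ) (hm : Odd m) :
    Real.cos (m * Real.pi / n) ≤ Real.cos (Real.pi / n) ∧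
      (Real.cos (m * Real.pi / n) = Real.cos (Real.pi / n) →
        (2 * n : ℤ) ∣ m - 1 ∨ (2 * n : ℤ) ∣ m + 1) := by
  have hn' : (n : ℝ) ≠ 0 := by exact_mod_cast hn
  have h0 := Int.emod_nonneg m (by omega : (2 * n : ℤ) ≠ 0)
  have h1 := Int.emod_lt_of_pos m (by omega : (0 : ℤ) < 2 * n)
  have hdiv := Int.emod_add_mul_ediv m (2 * n)
  set b := m % (2 * n)
  set q := m / (2 * n)
  have hb : b % 2 = 1 := by
    have h2 : m % 2 = 1 := Int.odd_iff.1 hm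
    rw [← hdiv, mul_assoc, Int.add_mul_emod_self_left] at h2
    exact h2
  have hcos : Real.cos (m * Real.pi / n) = Real.cos (b * Real.pi / n) := by
    rw [← Real.cos_add_int_mul_two_pi (b * Real.pi / n) q]
    congr 1
    rw [← hdiv]
    push_cast
    field_simp
  rw [hcos]
  rcases le_or_gt b n with hbn | hbn
  · obtain ⟨a, ha⟩ := Int.eq_ofNat_of_zero_le h0
    obtain ⟨h3, h4⟩ := cos_mul_pi_div_le (n := n) (a := a) (by omega) (by omega)
    have hba : (b : ℝ) = a := by rw [ha]; simp
    rw [hba]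
    refine ⟨h3, fun h => Or.inl ⟨q, ?_⟩⟩
    have := h4 h
    rw [← hdiv]
    omega
  · obtain ⟨a, ha⟩ := Int.eq_ofNat_of_zero_le (by omega : 0 ≤ 2 * n - b)
    obtain ⟨h3, h4⟩ := cos_mul_pi_div_le (n := n) (a := a) (by omega) (by omega)
    have hba : (b : ℝ) = 2 * n - a := by
      have : b = 2 * n - a := by omega
      rw [this]; push_cast; ring
    have hc : Real.cos (b * Real.pi / n) = Real.cos (a * Real.pi / n) := by
      have : b * Real.pi / n = 2 * Real.pi - a * Real.pi / n := by
        rw [hba]; field_simp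
      rw [this, Real.cos_two_pi_sub]
    rw [hc]
    refine ⟨h3, fun h => Or.inr ⟨q + 1, ?_⟩⟩
    have := h4 h
    rw [← hdiv, mul_add]
    omega

/-- The left side is the value at vertex `i` of the outward normal of the side from vertex 0 to
vertex 1; the right side is its value along that side. -/
theorem cos_side_le {n : ℕ} (hn : n ≠ 0) (i : ℤ) :
    Real.cos (2 * Real.pi * i / n - Real.pi / n) ≤ Real.cos (Real.pi / n) := by
  have := (cos_odd_mul_pi_div_le hn (2 * i - 1) ⟨i - 1, by ring⟩).1
  convert this using 2
  push_cast
  ring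

theorem cos_side_eq_iff {n : ℕ} (hn : n ≠ 0) (i : ℤ) :
    Real.cos (2 * Real.pi * i / n - Real.pi / n) = Real.cos (Real.pi / n) ↔
      (n : ℤ) ∣ i ∨ (n : ℤ) ∣ i - 1 := by
  have hn' : (n : ℝ) ≠ 0 := by exact_mod_cast hn
  constructor
  · intro h
    have := (cos_odd_mul_pi_div_le hn (2 * i - 1) ⟨i - 1, by ring⟩).2 (by
      rw [← h]
      congr 1
      push_cast
      ring)
    rcases this with ⟨q, hq⟩ | ⟨q, hq⟩
    · right
      exact ⟨q, by linarith⟩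
    · left
      exact ⟨q, by linarith⟩
  · rintro (⟨q, rfl⟩ | ⟨q, hq⟩)
    · have : 2 * Real.pi * ((n * q : ℤ) : ℝ) / n - Real.pi / n =
          -(Real.pi / n) + q * (2 * Real.pi) := by
        push_cast; field_simp; ring
      rw [this, Real.cos_add_int_mul_two_pi, Real.cos_neg]
    · have hi : i = n * q + 1 := by linarith
      have : 2 * Real.pi * (i : ℝ) / n - Real.pi / n =
          Real.pi / n + q * (2 * Real.pi) := by
        rw [hi]; push_cast; field_simp; ring
      rw [this, Real.cos_add_int_mul_two_pi]

/-- The linear functional with gradient `(cos β, sin β, c)`. -/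
def slopeFunctional (β c : ℝ) : StrongDual ℝ E3 :=
  Real.cos β • EuclideanSpace.proj 0 + Real.sin β • EuclideanSpace.proj 1 +
    c • EuclideanSpace.proj 2

theorem slopeFunctional_circlePoint (β c θ z : ℝ) :
    slopeFunctional β c (circlePoint θ z) = Real.cos (θ - β) + c * z := by
  simp [slopeFunctional, circlePoint, Real.cos_sub]
  ring

theorem slopeFunctional_ne_zero (β c : ℝ) : slopeFunctional β c ≠ 0 := by
  intro h
  have := slopeFunctional_circlePoint β c β 0
  rw [h] at this
  simp at this

/-- The vertices of a right prism (`α = 0`) or antiprism (`α = π / n`). -/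
def prismVertices (n : ℕ) (α h : ℝ) : Set E3 := gonVertices n 0 0 ∪ gonVertices n α h

theorem finite_prismVertices (n : ℕ) (α h : ℝ) : (prismVertices n α h).Finite :=
  (finite_gonVertices _ _ _).union (finite_gonVertices _ _ _)

theorem affineIndependent_of_linearIndependent {a b c : E3}
    (h : LinearIndependent ℝ ![b - a, c - a]) : AffineIndependent ℝ ![a, b, c] := by
  rw [affineIndependent_iff_linearIndependent_vsub ℝ _ (0 : Fin 3)]
  have := h.comp (fun i : {x : Fin 3 // x ≠ 0} => i.1.pred i.2) (fun i j hij => by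
    ext1; exact Fin.pred_inj.1 hij)
  convert! this using 2 with i
  obtain ⟨i, hi⟩ := i
  fin_cases i
  · exact absurd rfl hi
  · rfl
  · rfl

/-- The downward vertical functional exposes the base, and three distinct points of a circle are
affinely independent. -/
theorem isFace_base {n : ℕ} (hn : 3 ≤ n) {h : ℝ} (hh : 0 < h) (α : ℝ) :
    IsFace 2 (convexHull ℝ (prismVertices n α h)) (convexHull ℝ (gonVertices n 0 0)) := by
  have hn0 : n ≠ 0 := by omega
  have hz : ∀ {β z x}, x ∈ gonVertices n β z → x 2 = z := by
    rintro β z _ ⟨k, _, rfl⟩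
    exact (circlePoint_apply _ _).2.2
  let l : StrongDual ℝ E3 := -EuclideanSpace.proj 2
  have hl : ∀ x, l x = -x 2 := fun x => rfl
  have hind : AffineIndependent ℝ ![gonPoint n 0 0 0, gonPoint n 0 0 1, gonPoint n 0 0 2] := by
    have hne : ∀ j k : ℤ, |j - k| < n → j ≠ k → gonPoint n 0 0 j ≠ gonPoint n 0 0 k := by
      intro j k hjk hne heq
      have := Int.eq_zero_of_abs_lt_dvd ((gonPoint_eq_iff hn0 0 0).1 heq) hjk
      omega
    apply EuclideanGeometry.Cospherical.affineIndependent_of_ne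
    · refine ⟨0, 1, ?_⟩
      rintro p (rfl | rfl | rfl) <;> rw [dist_zero_right, norm_gonPoint_zero]
    all_goals apply hne
    all_goals norm_num
    all_goals omega
  refine isFace_two_convexHull l ?_ 0 ?_ ?_ hind ?_
  · intro h0
    have := hl (gonPoint n 0 1 0)
    rw [h0] at this
    simp [gonPoint, circlePoint] at this
  · rintro a (ha | ha) <;> rw [hl, hz ha] <;> linarith
  · ext x
    constructor
    · intro hx
      exact ⟨Or.inl hx, by rw [hl, hz hx, neg_zero]⟩
    · rintro ⟨hx | hx, h0⟩
      · exact hx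
      · rw [hl, hz hx] at h0
        linarith
  · intro i
    rw [gonVertices_eq_range hn0]
    fin_cases i
    · exact mem_range_self 0
    · exact mem_range_self 1
    · exact mem_range_self 2

/-- The lateral face of a prism or antiprism with base edge from vertex `k` to vertex `k + 1`, for
a suitable slope `c`. -/
def lateralFace (n : ℕ) (α h c : ℝ) (k : ℤ) : Set E3 :=
  convexHull ℝ {a ∈ prismVertices n α h |
    slopeFunctional (2 * Real.pi * k / n + Real.pi / n) c a = Real.cos (Real.pi / n)}

theorem slopeFunctional_gonPoint (n : ℕ) (α z c : ℝ) (j k : ℤ) :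
    slopeFunctional (2 * Real.pi * k / n + Real.pi / n) c (gonPoint n α z j) =
      Real.cos (2 * Real.pi * (j - k : ℤ) / n - Real.pi / n + α) + c * z := by
  rw [gonPoint, slopeFunctional_circlePoint]
  congr 2
  push_cast
  ring

section

variable {n : ℕ} {α h c : ℝ}

/-- Vertices of the base belong to the expected lateral faces. -/
theorem gonPoint_mem_lateralFace_iff (hn : n ≠ 0) (hle : ∀ i : ℤ,
      Real.cos (2 * Real.pi * i / n - Real.pi / n + α) + c * h ≤ Real.cos (Real.pi / n))
    (j k : ℤ) :
    gonPoint n 0 0 j ∈ lateralFace n α h c k ↔ (n : ℤ) ∣ j - k ∨ (n : ℤ) ∣ j - k - 1 := by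
  set l := slopeFunctional (2 * Real.pi * k / n + Real.pi / n) c with hl
  have hmem : gonPoint n 0 0 j ∈ prismVertices n α h :=
    Or.inl (by rw [gonVertices_eq_range hn]; exact mem_range_self j)
  -- The slope `c` does not affect the base, which lies at height 0; the top vertices are controlled
  -- by `hle`.
  have hle' : ∀ a ∈ prismVertices n α h, (l : E3 →ₗ[ℝ] ℝ) a ≤ Real.cos (Real.pi / n) := by
    rintro a (ha | ha) <;> rw [gonVertices_eq_range hn] at ha <;> obtain ⟨i, rfl⟩ := ha
    · change l _ ≤ _
      rw [hl, slopeFunctional_gonPoint]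
      simpa using cos_side_le hn (i - k)
    · change l _ ≤ _
      rw [hl, slopeFunctional_gonPoint]
      exact hle (i - k)
  have hF := convexHull_inter_level _ (l : E3 →ₗ[ℝ] ℝ) _ hle'
  rw [← cos_side_eq_iff hn (j - k)]
  have hval : l (gonPoint n 0 0 j) = Real.cos (2 * Real.pi * (j - k : ℤ) / n - Real.pi / n) := by
    rw [hl, slopeFunctional_gonPoint]
    simp
  have hF' : lateralFace n α h c k =
      {x ∈ convexHull ℝ (prismVertices n α h) | (l : E3 →ₗ[ℝ] ℝ) x = Real.cos (Real.pi / n)} :=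
    hF.symm
  rw [hF', ← hval]
  exact ⟨fun hx => hx.2, fun hx => ⟨subset_convexHull ℝ _ hmem, hx⟩⟩

/-- Lateral faces are told apart by their base vertices. Three faces suffice, since they outnumber
the two end points of an edge. -/
theorem lateralFace_injective (hn : 3 ≤ n) (hle : ∀ i : ℤ,
      Real.cos (2 * Real.pi * i / n - Real.pi / n + α) + c * h ≤ Real.cos (Real.pi / n)) :
    Function.Injective fun i : Fin 3 => lateralFace n α h c (i : ℕ) := by
  have hn0 : n ≠ 0 := by omega
  have key : ∀ j k m : ℤ, |j - k| < n → |j - k - 1| < n → j ≠ k → j ≠ k + 1 →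
      (j = m ∨ j = m + 1) → lateralFace n α h c m ≠ lateralFace n α h c k := by
    intro j k m h1 h2 h3 h4 h5 heq
    have hm : gonPoint n 0 0 j ∈ lateralFace n α h c m := by
      rw [gonPoint_mem_lateralFace_iff hn0 hle]
      rcases h5 with rfl | rfl <;> simp
    rw [heq, gonPoint_mem_lateralFace_iff hn0 hle] at hm
    rcases hm with hm | hm
    · have := Int.eq_zero_of_abs_lt_dvd hm h1
      omega
    · have := Int.eq_zero_of_abs_lt_dvd hm h2
      omega
  have h01 : lateralFace n α h c (0 : ℕ) ≠ lateralFace n α h c (1 : ℕ) :=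
    key 0 1 0 (by norm_num; omega) (by norm_num; omega) (by norm_num) (by norm_num) (by norm_num)
  have h02 : lateralFace n α h c (0 : ℕ) ≠ lateralFace n α h c (2 : ℕ) :=
    key 1 2 0 (by norm_num; omega) (by norm_num; omega) (by norm_num) (by norm_num) (by norm_num)
  have h12 : lateralFace n α h c (1 : ℕ) ≠ lateralFace n α h c (2 : ℕ) :=
    key 1 2 1 (by norm_num; omega) (by norm_num; omega) (by norm_num) (by norm_num) (by norm_num)
  intro i j hij
  fin_cases i <;> fin_cases j <;> first | rfl | exfalso
  · exact h01 hij
  · exact h02 hij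
  · exact h01 hij.symm
  · exact h12 hij
  · exact h02 hij.symm
  · exact h12 hij.symm

/-- The supporting plane contains the base edge from `k` to `k + 1` and, by `heq`, the top vertex
`k`; positive height makes these three points independent. Slope `c = 0` gives the vertical sides of
a prism, a negative `c` the tilted triangles of an antiprism. -/
theorem isFace_lateralFace (hn : 3 ≤ n) (hh : 0 < h) (hle : ∀ i : ℤ,
      Real.cos (2 * Real.pi * i / n - Real.pi / n + α) + c * h ≤ Real.cos (Real.pi / n))
    (k : ℤ) (heq : Real.cos (-(Real.pi / n) + α) + c * h = Real.cos (Real.pi / n)) :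
    IsFace 2 (convexHull ℝ (prismVertices n α h)) (lateralFace n α h c k) := by
  have hn0 : n ≠ 0 := by omega
  have hp : ∀ j, gonPoint n 0 0 j ∈ prismVertices n α h := fun j =>
    Or.inl (by rw [gonVertices_eq_range hn0]; exact mem_range_self j)
  have hq : ∀ j, gonPoint n α h j ∈ prismVertices n α h := fun j =>
    Or.inr (by rw [gonVertices_eq_range hn0]; exact mem_range_self j)
  have hind : AffineIndependent ℝ
      ![gonPoint n 0 0 k, gonPoint n 0 0 (k + 1), gonPoint n α h k] := by
    apply affineIndependent_of_linearIndependent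
    rw [LinearIndependent.pair_iff]
    intro s t hst
    have ht : t = 0 := by
      have := congrArg (fun x : E3 => x 2) hst
      simpa [gonPoint, circlePoint, hh.ne'] using this
    subst ht
    have hne : gonPoint n 0 0 (k + 1) - gonPoint n 0 0 k ≠ 0 := by
      rw [sub_ne_zero]
      intro heq
      have h1 := (gonPoint_eq_iff hn0 0 0).1 heq
      have := Int.eq_zero_of_abs_lt_dvd h1 (by norm_num; omega)
      omega
    rw [zero_smul, add_zero] at hst
    exact ⟨(smul_eq_zero.1 hst).resolve_right hne, rfl⟩
  refine isFace_two_convexHull _ (slopeFunctional_ne_zero _ c) _ ?_ rfl hind ?_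
  · rintro a (ha | ha) <;> rw [gonVertices_eq_range hn0] at ha <;> obtain ⟨i, rfl⟩ := ha
    · rw [slopeFunctional_gonPoint]
      simpa using cos_side_le hn0 (i - k)
    · rw [slopeFunctional_gonPoint]
      exact hle (i - k)
  · intro i
    fin_cases i
    · refine ⟨hp _, ?_⟩
      simp only [Fin.zero_eta, Matrix.cons_val_zero]
      rw [slopeFunctional_gonPoint]
      simp
    · refine ⟨hp _, ?_⟩
      change slopeFunctional _ c (gonPoint n 0 0 (k + 1)) = _
      rw [slopeFunctional_gonPoint]
      simpa using (cos_side_eq_iff hn0 1).2 (by simp)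
    · refine ⟨hq _, ?_⟩
      simp only [Fin.reduceFinMk, Matrix.cons_val]
      rw [slopeFunctional_gonPoint]
      simpa [neg_add_eq_sub] using heq

theorem extremePoints_lateralFace_subset (n : ℕ) (α h c : ℝ) (hn : n ≠ 0) (k : ℤ) :
    extremePoints ℝ (lateralFace n α h c k) ⊆
      {gonPoint n 0 0 k, gonPoint n 0 0 (k + 1)} ∪
      {x | ∃ j, x = gonPoint n α h j ∧
        Real.cos (2 * Real.pi * (j - k : ℤ) / n - Real.pi / n + α) + c * h =
          Real.cos (Real.pi / n)} := by
  refine extremePoints_convexHull_subset.trans ?_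
  rintro a ⟨ha | ha, hl⟩ <;> rw [gonVertices_eq_range hn] at ha <;> obtain ⟨j, rfl⟩ := ha
  · left
    rw [slopeFunctional_gonPoint] at hl
    simp only [add_zero, mul_zero] at hl
    rcases (cos_side_eq_iff hn _).1 hl with h1 | h1
    · left
      exact gonPoint_eq_of_dvd hn _ _ h1
    · right
      exact gonPoint_eq_of_dvd hn _ _ (by rwa [← sub_sub])
  · right
    rw [slopeFunctional_gonPoint] at hl
    exact ⟨j, rfl, hl⟩

end

/-- A polytope has an `n`-gonal face and three further two-dimensional faces with at most four
vertices each. -/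
def HasLateralFaces (n : ℕ) (K : Set E3) : Prop :=
  (∃ F, IsFace 2 K F ∧ IsRegularPolygon n F) ∧
  ∃ F : Fin 3 → Set E3, Function.Injective F ∧
    ∀ i, IsFace 2 K (F i) ∧ ∀ m, IsRegularPolygon m (F i) → m ≤ 4

theorem isRegularPolygon_base {n : ℕ} (hn : 3 ≤ n) :
    IsRegularPolygon n (convexHull ℝ (gonVertices n 0 0)) :=
  ⟨hn, DilationEquiv.refl E3, by simp⟩

theorem HasLateralFaces.image (g : E3 ≃ᵈ E3) {n : ℕ} {K : Set E3} (hK : HasLateralFaces n K) :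
    HasLateralFaces n (g '' K) := by
  obtain ⟨⟨B, hB, hB'⟩, F, hF, hF'⟩ := hK
  refine ⟨⟨g '' B, hB.similarity_image g, hB'.image g⟩, fun i => g '' F i,
    fun i j hij => hF (g.injective.image_injective hij), fun i =>
    ⟨(hF' i).1.similarity_image g, fun m hm => (hF' i).2 m (hm.of_image g)⟩⟩

theorem cos_pi_div_lt_one {n : ℕ} (hn : 3 ≤ n) : Real.cos (2 * Real.pi * (1 : ℤ) / n) < 1 := by
  refine lt_of_le_of_ne (Real.cos_le_one _) fun h => ?_
  have := (cos_two_pi_mul_div_eq_one (by omega) 1).1 h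
  have := Int.eq_zero_of_abs_lt_dvd this (by norm_num; omega)
  omega

theorem extremePoints_lateralFace_prism_subset {n : ℕ} (hn : n ≠ 0) (h : ℝ) (k : ℤ) :
    extremePoints ℝ (lateralFace n 0 h 0 k) ⊆
      {gonPoint n 0 0 k, gonPoint n 0 0 (k + 1), gonPoint n 0 h k, gonPoint n 0 h (k + 1)} := by
  refine (extremePoints_lateralFace_subset n 0 h 0 hn k).trans ?_
  rintro a ((rfl | rfl) | ⟨j, rfl, hj⟩)
  · simp
  · simp
  · rw [zero_mul, add_zero, add_zero, cos_side_eq_iff hn] at hj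
    rcases hj with hj | hj
    · rw [gonPoint_eq_of_dvd hn _ _ hj]
      simp
    · rw [gonPoint_eq_of_dvd hn _ _ (by rwa [← sub_sub] : (n : ℤ) ∣ j - (k + 1))]
      simp

theorem lateralFace_prism_conditions (n : ℕ) (hn : n ≠ 0) (h : ℝ) :
    (∀ i : ℤ, Real.cos (2 * Real.pi * i / n - Real.pi / n + 0) + 0 * h ≤
      Real.cos (Real.pi / n)) ∧
    Real.cos (-(Real.pi / n) + 0) + 0 * h = Real.cos (Real.pi / n) :=
  ⟨fun i => by simpa using cos_side_le hn i, by simp⟩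

theorem hasLateralFaces_prism {n : ℕ} (hn : 3 ≤ n) {h : ℝ} (hh : 0 < h) :
    HasLateralFaces n (convexHull ℝ (prismVertices n 0 h)) := by
  have hn0 : n ≠ 0 := by omega
  obtain ⟨h1, h2⟩ := lateralFace_prism_conditions n hn0 h
  refine ⟨⟨_, isFace_base hn hh 0, isRegularPolygon_base hn⟩, _, lateralFace_injective hn h1,
    fun i => ⟨isFace_lateralFace hn hh h1 _ h2, fun m hm => ?_⟩⟩
  exact (hm.le_ncard (Set.toFinite _) (extremePoints_lateralFace_prism_subset hn0 h _)).trans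
    (by classical
        rw [← Finset.coe_singleton, ← Finset.coe_insert, ← Finset.coe_insert, ← Finset.coe_insert,
          ncard_coe_finset]
        exact Finset.card_le_four)

/-- A prism with a regular lateral face has square lateral faces. -/
theorem height_sq_of_prism {n : ℕ} (hn : 3 ≤ n) {h : ℝ} (hh : 0 < h) {m : ℕ} {k : ℤ}
    (hm : IsRegularPolygon m (lateralFace n 0 h 0 k)) :
    h ^ 2 = 2 - 2 * Real.cos (2 * Real.pi * (1 : ℤ) / n) := by
  have hn0 : n ≠ 0 := by omega
  have hsub := extremePoints_lateralFace_prism_subset hn0 h k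
  obtain ⟨a, ha, b, hb, c, hc, hab, hac, hbc, hd, -⟩ := hm.exists_three
  replace ha := hsub ha
  replace hb := hsub hb
  replace hc := hsub hc
  rw [← sq_eq_sq₀ dist_nonneg dist_nonneg] at hd
  have hw := cos_pi_div_lt_one hn
  set w := Real.cos (2 * Real.pi * (1 : ℤ) / n) with hw'
  have e1 : Real.cos (2 * Real.pi * (-1 : ℤ) / n) = w := by
    rw [← Real.cos_neg, hw']
    congr 1
    push_cast
    ring
  have hh2 : 0 < h ^ 2 := by positivity
  have d1 : k - (k + 1) = -1 := by ring
  have d2 : k + 1 - k = 1 := by ring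
  -- Three corners of a rectangle form a right triangle. Two of its sides can be equal only if they
  -- are the legs, a base edge and the height.
  rcases ha with rfl | rfl | rfl | rfl <;> rcases hb with rfl | rfl | rfl | rfl <;>
    first
    | exact absurd rfl hab
    | (rcases hc with rfl | rfl | rfl | rfl <;>
        first
        | exact absurd rfl hac
        | exact absurd rfl hbc
        | (simp only [dist_gonPoint_sq, sub_self, add_zero, d1, d2, e1, ← hw', Int.cast_zero,
            mul_zero, zero_div, Real.cos_zero, zero_sub, sub_zero, neg_sq] at hd
           linarith))

theorem extremePoints_lateralFace_antiprism_subset {n : ℕ} (hn : n ≠ 0) {h : ℝ} (hh : 0 < h)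
    (k : ℤ) :
    extremePoints ℝ (lateralFace n (Real.pi / n) h ((Real.cos (Real.pi / n) - 1) / h) k) ⊆
      {gonPoint n 0 0 k, gonPoint n 0 0 (k + 1), gonPoint n (Real.pi / n) h k} := by
  refine (extremePoints_lateralFace_subset n _ h _ hn k).trans ?_
  rintro a ((rfl | rfl) | ⟨j, rfl, hj⟩)
  · simp
  · simp
  · rw [div_mul_cancel₀ _ hh.ne', sub_add_cancel] at hj
    have : (n : ℤ) ∣ j - k := (cos_two_pi_mul_div_eq_one hn _).1 (by linarith)
    rw [gonPoint_eq_of_dvd hn _ _ this]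
    simp

theorem lateralFace_antiprism_conditions (n : ℕ) {h : ℝ} (hh : 0 < h) :
    (∀ i : ℤ, Real.cos (2 * Real.pi * i / n - Real.pi / n + Real.pi / n) +
      (Real.cos (Real.pi / n) - 1) / h * h ≤ Real.cos (Real.pi / n)) ∧
    Real.cos (-(Real.pi / n) + Real.pi / n) + (Real.cos (Real.pi / n) - 1) / h * h =
      Real.cos (Real.pi / n) := by
  rw [div_mul_cancel₀ _ hh.ne']
  refine ⟨fun i => ?_, by simp⟩
  have := Real.cos_le_one (2 * Real.pi * i / n - Real.pi / n + Real.pi / n)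
  linarith

theorem hasLateralFaces_antiprism {n : ℕ} (hn : 3 ≤ n) {h : ℝ} (hh : 0 < h) :
    HasLateralFaces n (convexHull ℝ (prismVertices n (Real.pi / n) h)) := by
  have hn0 : n ≠ 0 := by omega
  obtain ⟨h1, h2⟩ := lateralFace_antiprism_conditions n hh
  refine ⟨⟨_, isFace_base hn hh _, isRegularPolygon_base hn⟩, _, lateralFace_injective hn h1,
    fun i => ⟨isFace_lateralFace hn hh h1 _ h2, fun m hm => ?_⟩⟩
  refine (hm.le_ncard (Set.toFinite _)
    (extremePoints_lateralFace_antiprism_subset hn0 hh _)).trans ?_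
  classical
  rw [← Finset.coe_singleton, ← Finset.coe_insert, ← Finset.coe_insert, ncard_coe_finset]
  exact Finset.card_le_three.trans (by norm_num)

/-- An antiprism with a regular lateral face has equilateral lateral faces. -/
theorem height_sq_of_antiprism {n : ℕ} (hn : 3 ≤ n) {h : ℝ} (hh : 0 < h) {m : ℕ} {k : ℤ}
    (hm : IsRegularPolygon m
      (lateralFace n (Real.pi / n) h ((Real.cos (Real.pi / n) - 1) / h) k)) :
    h ^ 2 = 2 * Real.cos (Real.pi / n) - 2 * Real.cos (2 * Real.pi * (1 : ℤ) / n) := by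
  have hn0 : n ≠ 0 := by omega
  have hsub := extremePoints_lateralFace_antiprism_subset hn0 hh k
  have hm3 : m = 3 := by
    refine le_antisymm ((hm.le_ncard (Set.toFinite _) hsub).trans ?_) hm.1
    classical
    rw [← Finset.coe_singleton, ← Finset.coe_insert, ← Finset.coe_insert, ncard_coe_finset]
    exact Finset.card_le_three
  obtain ⟨a, ha, b, hb, c, hc, hab, hac, hbc, hd, hd3⟩ := hm.exists_three
  -- If `b` is the apex, `dist a b = dist b c` only compares the two legs, so the third side is
  -- needed too.
  have hd3 := hd3 hm3
  replace ha := hsub ha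
  replace hb := hsub hb
  replace hc := hsub hc
  rw [← sq_eq_sq₀ dist_nonneg dist_nonneg] at hd hd3
  set w := Real.cos (2 * Real.pi * (1 : ℤ) / n) with hw'
  set u := Real.cos (Real.pi / n) with hu
  have e1 : Real.cos (2 * Real.pi * (-1 : ℤ) / n) = w := by
    rw [← Real.cos_neg, hw']
    congr 1
    push_cast
    ring
  have u1 : Real.cos (-(Real.pi / n)) = u := Real.cos_neg _
  have u2 : Real.cos (2 * Real.pi * (1 : ℤ) / n + -(Real.pi / n)) = u := by
    rw [hu]
    congr 1
    push_cast
    ring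
  have u3 : Real.cos (2 * Real.pi * (-1 : ℤ) / n + Real.pi / n) = u := by
    rw [← Real.cos_neg, hu]
    congr 1
    push_cast
    ring
  have d1 : k - (k + 1) = -1 := by ring
  have d2 : k + 1 - k = 1 := by ring
  rcases ha with rfl | rfl | rfl <;> rcases hb with rfl | rfl | rfl <;>
    first
    | exact absurd rfl hab
    | (rcases hc with rfl | rfl | rfl <;>
        first
        | exact absurd rfl hac
        | exact absurd rfl hbc
        | (simp only [dist_gonPoint_sq, sub_self, add_zero, zero_add, d1, d2, e1, ← hw', ← hu,
            Int.cast_zero, mul_zero, zero_div, zero_sub, sub_zero, neg_sq, u1, u2,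
            u3] at hd hd3
           linarith))

/-! ### The possible solids -/

theorem finite_signedPerms (G : Set (Equiv.Perm (Fin 3) × (Fin 3 → ℤˣ))) (a b c : ℝ) :
    (signedPerms G a b c).Finite := by
  refine ((Set.toFinite G).image fun g => (WithLp.toLp 2 fun i : Fin 3 =>
    ((g.2 i : ℤ) : ℝ) * ![a, b, c] (g.1 i) : E3)).subset ?_
  rintro x ⟨g, hg, hx⟩
  refine ⟨g, hg, ?_⟩
  ext i
  exact (hx i).symm

theorem finite_platonicVertexSets : platonicVertexSets.Finite := by
  unfold platonicVertexSets
  exact Set.toFinite _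

open Polynomial in
-- The two snub families are indexed by real roots of non-zero cubics, hence are finite without
-- identifying the roots.
theorem finite_archimedeanVertexSets : archimedeanVertexSets.Finite := by
  have h1 : {t : ℝ | t ^ 3 = t ^ 2 + t + 1}.Finite := by
    have hp : (X ^ 3 - X ^ 2 - X - 1 : ℝ[X]) ≠ 0 := by
      intro h
      have := congrArg (eval 0) h
      simp at this
    refine (finite_setOfPred_isRoot hp).subset fun t ht => ?_
    have ht : t ^ 3 = t ^ 2 + t + 1 := ht
    simp [IsRoot, ht]
    ring
  have h2 : {t : ℝ | t ^ 3 = 2 * t + φ}.Finite := by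
    have hp : (X ^ 3 - C 2 * X - C φ : ℝ[X]) ≠ 0 := by
      intro h
      have := congrArg (eval 0) h
      simp only [eval_sub, eval_mul, eval_pow, eval_X, eval_C, eval_zero] at this
      exact Real.goldenRatio_ne_zero (by linarith)
    refine (finite_setOfPred_isRoot hp).subset fun t ht => ?_
    have ht : t ^ 3 = 2 * t + φ := ht
    simp [IsRoot, ht]
  unfold archimedeanVertexSets
  refine (Set.Finite.union (Set.toFinite _) ?_).union ?_
  · refine (h1.image snubCubeVertices).subset ?_
    rintro _ ⟨t, ht, rfl⟩
    exact ⟨t, ht, rfl⟩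
  · refine (h2.image snubDodecahedronVertices).subset ?_
    rintro _ ⟨t, ht, rfl⟩
    exact ⟨t, ht, rfl⟩

theorem finite_of_mem_platonic_union_archimedean {A : Set E3}
    (hA : A ∈ platonicVertexSets ∪ archimedeanVertexSets) : A.Finite := by
  rcases hA with hA | (hA | ⟨t, -, rfl⟩) | ⟨t, -, rfl⟩
  · simp only [platonicVertexSets, mem_insert_iff, mem_singleton_iff] at hA
    rcases hA with rfl | rfl | rfl | rfl | rfl <;> simp [finite_signedPerms]
  · simp only [mem_insert_iff, mem_singleton_iff] at hA
    rcases hA with rfl | rfl | rfl | rfl | rfl | rfl | rfl | rfl | rfl | rfl | rfl <;>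
      simp [finite_signedPerms]
  · exact finite_signedPerms _ _ _ _
  · simp [snubDodecahedronVertices, finite_signedPerms]

/-- The bound `N` will dominate both `r` and the 4 coming from lateral faces. -/
theorem exists_ncard_le : ∃ N : ℕ, 4 ≤ N ∧
    ∀ A ∈ platonicVertexSets ∪ archimedeanVertexSets, A.ncard ≤ N := by
  obtain ⟨N, hN⟩ := ((finite_platonicVertexSets.union
    finite_archimedeanVertexSets).image ncard).bddAbove
  exact ⟨max 4 N, le_max_left _ _, fun A hA =>
    (hN (mem_image_of_mem _ hA)).trans (le_max_right _ _)⟩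

/-- The vertex set of the prism over a regular `n`-gon with square lateral faces. -/
def uniformPrism (n : ℕ) : Set E3 :=
  prismVertices n 0 √(2 - 2 * Real.cos (2 * Real.pi * (1 : ℤ) / n))

/-- The vertex set of the antiprism over a regular `n`-gon with equilateral lateral faces. -/
def uniformAntiprism (n : ℕ) : Set E3 :=
  prismVertices n (Real.pi / n)
    √(2 * Real.cos (Real.pi / n) - 2 * Real.cos (2 * Real.pi * (1 : ℤ) / n))

/-- Vertex sets of the Platonic and Archimedean solids and of uniform prisms and antiprisms over
polygons with at most `N` vertices. -/
def modelVertexSets (N : ℕ) : Set (Set E3) :=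
  platonicVertexSets ∪ archimedeanVertexSets ∪
    (uniformPrism '' {n | n ≤ N} ∪ uniformAntiprism '' {n | n ≤ N})

theorem finite_modelVertexSets (N : ℕ) : (modelVertexSets N).Finite :=
  (finite_platonicVertexSets.union finite_archimedeanVertexSets).union
    (((finite_le_nat N).image _).union ((finite_le_nat N).image _))

theorem finite_of_mem_modelVertexSets {N : ℕ} {A : Set E3} (hA : A ∈ modelVertexSets N) :
    A.Finite := by
  rcases hA with hA | ⟨n, -, rfl⟩ | ⟨n, -, rfl⟩
  · exact finite_of_mem_platonic_union_archimedean hA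
  · exact finite_prismVertices _ _ _
  · exact finite_prismVertices _ _ _

/-! ### Faces in a regular decoration -/

section

variable {Γ : Geometry.SimplicialComplex ℝ E3} {solid : Finset E3 → Set E3} {p q r : ℕ}

/-- Each face of a solid is a boundary face or is shared with an adjacent solid. -/
theorem IsDecoration.boundary_or_glued (hD : IsDecoration Γ solid) {s : Finset E3}
    (hs : s ∈ Γ.faces) {F : Set E3} (hF : IsFace 2 (solid s) F) :
    F ∈ boundaryFaces Γ solid ∨ ∃ t ∈ Γ.faces, Adjacent Γ solid s t ∧ F = solid s ∩ solid t := by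
  by_cases hb : F ∈ boundaryFaces Γ solid
  · exact Or.inl hb
  right
  have : ∃ t ∈ Γ.faces, t ≠ s ∧ IsFace 2 (solid t) F := by
    by_contra! h
    exact hb ⟨s, hs, hF, h⟩
  obtain ⟨t, ht, hts, hFt⟩ := this
  have hsub : F ⊆ solid s ∩ solid t := subset_inter hF.subset hFt.subset
  -- Sharing `F` makes the intersection at least two-dimensional, which non-adjacent solids may not
  -- do. Then `F` is a face inside the gluing face, of the same dimension.
  have hadj : Adjacent Γ solid s t := by
    by_contra hna
    have h1 := hD.not_glued s hs t ht hts.symm hna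
    have h2 := Submodule.finrank_mono (vectorSpan_mono ℝ hsub)
    rw [hF.2.2] at h2
    omega
  exact ⟨t, ht, hadj, hF.eq_of_subset (hD.glued s hs t ht hadj).1 hsub⟩

theorem IsRegularDecoration.regular_face (hD : IsRegularDecoration Γ solid p q r) {s : Finset E3}
    (hs : s ∈ Γ.faces) {F : Set E3} (hF : IsFace 2 (solid s) F) :
    IsRegularPolygon p F ∨ IsRegularPolygon r F := by
  rcases hD.boundary_or_glued hs hF with h | ⟨t, ht, hadj, rfl⟩
  · exact Or.inl (hD.tiling.polygon F h)
  · exact Or.inr (hD.polygon s hs t ht hadj)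

/-- An edge is a maximal simplex, so only its end points remain; adjacency across an empty solid
would require `solid e` itself to be empty. -/
theorem eq_singleton_of_adjacent_edge (hΓ : IsSkeletalGraph Γ) {e t : Finset E3} {x y : E3}
    (hxy : x ≠ y) (hexy : e = {x, y}) (ht : t ∈ Γ.faces)
    (h : Adjacent Γ solid e t) : t = {x} ∨ t = {y} := by
  have hcard : e.card = 2 := by rw [hexy]; exact Finset.card_pair hxy
  have hmax : ∀ e' ∈ Γ.faces, e ⊆ e' → e = e' := fun e' he' hsub =>
    Finset.eq_of_subset_of_card_le hsub ((hΓ.1 e' he').trans hcard.ge)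
  obtain ⟨hne, hse, -, h | h | ⟨e', he', hemp, h, -⟩⟩ := h
  · exact absurd (hmax t ht h) hne
  · have htne := Γ.nonempty_of_mem_faces ht
    have h' : (t : Set E3) ⊆ {x, y} := by
      rw [← Finset.coe_pair, ← hexy]
      exact_mod_cast h
    rw [subset_pair_iff_eq] at h'
    norm_cast at h'
    rcases h' with rfl | rfl | rfl | rfl
    · exact absurd htne (by simp)
    · exact Or.inl rfl
    · exact Or.inr rfl
    · exact absurd hexy hne
  · rw [hmax e' he' h] at hse
    exact absurd hemp hse.ne_empty

/-- The base of a prism or antiprism that replaces an edge has few vertices. -/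
theorem IsRegularDecoration.le_of_hasLateralFaces (hD : IsRegularDecoration Γ solid p q r)
    (hΓ : IsSkeletalGraph Γ) {e : Finset E3} (he : e ∈ Γ.faces) (hcard : e.card = 2) {n : ℕ}
    (hn : HasLateralFaces n (solid e)) : n ≤ max 4 r := by
  classical
  obtain ⟨x, y, hxy, hexy⟩ := Finset.card_eq_two.1 hcard
  obtain ⟨⟨B, hB, hBn⟩, F, hFinj, hF⟩ := hn
  -- If `p > 4`, no lateral face is a tile, so three distinct faces would be glued to only two end
  -- point solids.
  have hp : p ≤ 4 := by
    by_contra hp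
    have hglued : ∀ i, ∃ t, (t = {x} ∨ t = {y}) ∧ F i = solid e ∩ solid t := by
      intro i
      rcases hD.boundary_or_glued he (hF i).1 with h | ⟨t, ht, hadj, h⟩
      · exact absurd ((hF i).2 p (hD.tiling.polygon _ h)) hp
      · exact ⟨t, eq_singleton_of_adjacent_edge hΓ hxy hexy ht hadj, h⟩
    choose t ht hFt using hglued
    have hcase : ∀ i j, t i = t j → i = j := fun i j hij => hFinj (by rw [hFt, hFt, hij])
    have h01 := hcase 0 1
    have h02 := hcase 0 2
    have h12 := hcase 1 2
    rcases ht 0 with h0 | h0 <;> rcases ht 1 with h1 | h1 <;> rcases ht 2 with h2 | h2 <;>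
      simp [h0, h1, h2] at h01 h02 h12
  rcases hD.regular_face he hB with h | h
  · have : n = p := hBn.ncard_extremePoints.symm.trans h.ncard_extremePoints
    exact this ▸ hp.trans (le_max_left _ _)
  · have : n = r := hBn.ncard_extremePoints.symm.trans h.ncard_extremePoints
    exact this ▸ le_max_right _ _

/-- The shared `r`-gon is a face of a Platonic or Archimedean solid, so its vertices are among the
vertices of that solid. -/
theorem IsRegularDecoration.le_of_adjacent (hD : IsRegularDecoration Γ solid p q r)
    (hA : IsArchimedean Γ solid) {N : ℕ}
    (hN : ∀ A ∈ platonicVertexSets ∪ archimedeanVertexSets, A.ncard ≤ N)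
    {s t : Finset E3} (hs : s ∈ Γ.faces) (hcard : s.card = 1) (ht : t ∈ Γ.faces)
    (hadj : Adjacent Γ solid s t) : r ≤ N := by
  obtain ⟨A, hA, g, hg⟩ := hA.1 s hs hcard
  have hface := (hD.glued s hs t ht hadj).1
  have hpol := hD.polygon s hs t ht hadj
  have hfin := finite_of_mem_platonic_union_archimedean hA
  have hext : extremePoints ℝ (solid s ∩ solid t) ⊆ g '' A := by
    apply IsFace.extremePoints_subset (k := 2)
    rw [← similarity_image_convexHull, hg]
    exact hface
  refine (hpol.le_ncard (hfin.image g) hext).trans ?_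
  rw [ncard_image_of_injective _ g.injective]
  exact hN A hA

/-- Both parameters of a prism or antiprism are pinned down: the number of sides by `max 4 r ≤ N`,
the height by the regularity of one lateral face. -/
theorem exists_model_of_edge (hD : IsRegularDecoration Γ solid p q r)
    (hA : IsArchimedean Γ solid) (hΓ : IsSkeletalGraph Γ) {N : ℕ} (h4 : 4 ≤ N)
    (hN : ∀ A ∈ platonicVertexSets ∪ archimedeanVertexSets, A.ncard ≤ N)
    {e : Finset E3} (he : e ∈ Γ.faces) (hcard : e.card = 2) (hne : (solid e).Nonempty) :
    ∃ A ∈ modelVertexSets N, IsSimilar (convexHull ℝ A) (solid e) := by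
  have hr : r ≤ N := by
    obtain ⟨x, y, hxy, hexy⟩ := Finset.card_eq_two.1 hcard
    have hx : {x} ∈ Γ.faces := Γ.down_closed he (by simp [hexy]) (by simp)
    refine hD.le_of_adjacent hA hN hx (by simp) he ⟨?_, ?_, hne, ?_⟩
    · intro h
      rw [← h] at hcard
      simp at hcard
    · exact (hD.vertex_solid _ hx (by simp)).2.mono interior_subset
    · exact Or.inl (by simp [hexy])
  have hmax : max 4 r ≤ N := max_le h4 hr
  have hreg : ∀ F, IsFace 2 (solid e) F → ∃ m, IsRegularPolygon m F := fun F hF =>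
    (hD.regular_face he hF).elim (fun h => ⟨_, h⟩) fun h => ⟨_, h⟩
  rcases hA.2 e he hcard with h0 | ⟨n, hn, h, hh, g, hg⟩ | ⟨n, hn, h, hh, g, hg⟩
  · exact absurd h0 hne.ne_empty
  · change g '' convexHull ℝ (prismVertices n 0 h) = _ at hg
    have hnN := hD.le_of_hasLateralFaces hΓ he hcard (hg ▸ (hasLateralFaces_prism hn hh).image g)
    refine ⟨_, Or.inr (Or.inl ⟨n, hnN.trans hmax, rfl⟩), g, ?_⟩
    obtain ⟨h1, h2⟩ := lateralFace_prism_conditions n (by omega) h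
    obtain ⟨m, hm⟩ := hreg _ (hg ▸ (isFace_lateralFace hn hh h1 0 h2).similarity_image g)
    rw [uniformPrism, ← height_sq_of_prism hn hh (hm.of_image g), Real.sqrt_sq hh.le, hg]
  · change g '' convexHull ℝ (prismVertices n (Real.pi / n) h) = _ at hg
    have hnN := hD.le_of_hasLateralFaces hΓ he hcard
      (hg ▸ (hasLateralFaces_antiprism hn hh).image g)
    refine ⟨_, Or.inr (Or.inr ⟨n, hnN.trans hmax, rfl⟩), g, ?_⟩
    obtain ⟨h1, h2⟩ := lateralFace_antiprism_conditions n hh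
    obtain ⟨m, hm⟩ := hreg _ (hg ▸ (isFace_lateralFace hn hh h1 0 h2).similarity_image g)
    rw [uniformAntiprism, ← height_sq_of_antiprism hn hh (hm.of_image g), Real.sqrt_sq hh.le, hg]

theorem exists_model (hD : IsRegularDecoration Γ solid p q r)
    (hA : IsArchimedean Γ solid) (hΓ : IsSkeletalGraph Γ) {N : ℕ} (h4 : 4 ≤ N)
    (hN : ∀ A ∈ platonicVertexSets ∪ archimedeanVertexSets, A.ncard ≤ N)
    {s : Finset E3} (hs : s ∈ Γ.faces) (hne : (solid s).Nonempty) :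
    ∃ A ∈ modelVertexSets N, IsSimilar (convexHull ℝ A) (solid s) := by
  have h1 : s.card ≤ 2 := hΓ.1 s hs
  have h0 : 0 < s.card := (Γ.nonempty_of_mem_faces hs).card_pos
  rcases (by omega : s.card = 1 ∨ s.card = 2) with h | h
  · obtain ⟨A, hA, hsim⟩ := hA.1 s hs h
    exact ⟨A, Or.inl hA, hsim⟩
  · exact exists_model_of_edge hD hA hΓ h4 hN hs h hne

end

/-! ### Finitely many pieces -/

/-- The polytopes that can be reached from a model in standard position by attaching at most `k`
copies of models along common faces. -/
def placements (N : ℕ) : ℕ → Set (Set E3)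
  | 0 => convexHull ℝ '' modelVertexSets N
  | k + 1 => placements N k ∪ {K' | ∃ K ∈ placements N k, ∃ A ∈ modelVertexSets N,
      IsSimilar (convexHull ℝ A) K' ∧ IsFace 2 K (K ∩ K') ∧ IsFace 2 K' (K ∩ K')}

theorem exists_finite_of_mem_placements {N k : ℕ} {K : Set E3} (hK : K ∈ placements N k) :
    ∃ A : Set E3, A.Finite ∧ K = convexHull ℝ A := by
  induction k generalizing K with
  | zero =>
    obtain ⟨A, hA, rfl⟩ := hK
    exact ⟨A, finite_of_mem_modelVertexSets hA, rfl⟩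
  | succ k ih =>
    rcases hK with hK | ⟨_, _, A, hA, ⟨g, rfl⟩, _⟩
    · exact ih hK
    · exact ⟨g '' A, (finite_of_mem_modelVertexSets hA).image g, similarity_image_convexHull g A⟩

theorem finite_placements_model (N k : ℕ) : (placements N k).Finite := by
  induction k with
  | zero => exact (finite_modelVertexSets N).image _
  | succ k ih =>
    refine ih.union (Set.Finite.subset (ih.biUnion fun K hK =>
      (finite_modelVertexSets N).biUnion (t := fun A => {K' | IsSimilar (convexHull ℝ A) K' ∧
        IsFace 2 K (K ∩ K') ∧ IsFace 2 K' (K ∩ K')}) fun A hA => ?_) ?_)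
    · obtain ⟨B, hB, rfl⟩ := exists_finite_of_mem_placements hK
      exact finite_placements hB (finite_of_mem_modelVertexSets hA)
    · rintro K' ⟨K, hK, A, hA, h⟩
      exact mem_biUnion hK (mem_biUnion hA h)

theorem placements_mono (N : ℕ) : Monotone (placements N) :=
  monotone_nat_of_le_succ fun _ => subset_union_left

/-- The vectors that translate a placed polytope to another one. -/
def placementVectors (N k : ℕ) : Set E3 :=
  {u | ∃ K ∈ placements N k, K.Nonempty ∧ (fun x => x + u) '' K ∈ placements N k}

/-- A non-empty compact set has no non-zero translational symmetry: moving a maximizer of the inner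
product with `u - w` by `u - w` would increase the maximum. -/
theorem eq_of_translate_eq {K : Set E3} (hK : IsCompact K) (hne : K.Nonempty) {u w : E3}
    (h : (fun x => x + u) '' K = (fun x => x + w) '' K) : u = w := by
  have hcont : ContinuousOn (fun x : E3 => inner ℝ (u - w) x) K := by fun_prop
  obtain ⟨x, hx, hmax⟩ := hK.exists_isMaxOn hne hcont
  obtain ⟨y, hy, hyx⟩ : x + u ∈ (fun x => x + w) '' K := h ▸ mem_image_of_mem _ hx
  have hyx' : y = x + (u - w) := by
    have : y + w = x + u := hyx
    rw [← add_sub_assoc, ← this, add_sub_cancel_right]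
  have h1 : inner ℝ (u - w) y ≤ inner ℝ (u - w) x := hmax hy
  rw [hyx', inner_add_right] at h1
  have h2 : inner ℝ (u - w) (u - w) ≤ 0 := by linarith
  exact sub_eq_zero.1 (real_inner_self_nonpos.1 h2)

/-- Each ordered pair of placed polytopes contributes at most one vector. -/
theorem finite_placementVectors (N k : ℕ) : (placementVectors N k).Finite := by
  have hfin := finite_placements_model N k
  refine Set.Finite.subset (hfin.biUnion fun K hK => hfin.biUnion
    (t := fun K' => {u | K.Nonempty ∧ (fun x => x + u) '' K = K'}) fun K' _ => ?_) ?_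
  · refine Set.Subsingleton.finite ?_
    rintro u ⟨hne, hu⟩ w ⟨-, hw⟩
    obtain ⟨A, hA, rfl⟩ := exists_finite_of_mem_placements hK
    exact eq_of_translate_eq (Set.Finite.isCompact_convexHull ℝ hA) hne (hu.trans hw.symm)
  · rintro u ⟨K, hK, hne, hu⟩
    exact mem_biUnion hK (mem_biUnion hu ⟨hne, rfl⟩)

/-- The union of the translates of the members of `X` by the group generated by `V`. -/
def assembly (V : Set E3) (X : Set (Set E3)) : Set E3 :=
  ⋃ u ∈ AddSubgroup.closure V, ⋃ K ∈ X, (fun x => x + u) '' K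

/-! ### The pieces of a periodic decoration -/

section

variable {L : Submodule ℤ E3} {Γ : Geometry.SimplicialComplex ℝ E3}
  {solid : Finset E3 → Set E3} {p q r : ℕ}

theorem translate_singleton (v x : E3) : translate v {x} = {x + v} := by
  simp [translate]

theorem mem_translate_neg {v x : E3} {s : Finset E3} : x ∈ translate (-v) s ↔ x + v ∈ s := by
  simp only [translate, Finset.mem_map, addRightEmbedding_apply]
  constructor
  · rintro ⟨a, ha, rfl⟩
    simpa using ha
  · intro h
    exact ⟨x + v, h, by simp⟩

theorem translate_translate_neg (v : E3) (s : Finset E3) : translate v (translate (-v) s) = s := by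
  ext x
  have h := mem_translate_neg (v := -v) (x := x) (s := translate (-v) s)
  rw [neg_neg, mem_translate_neg] at h
  simpa using h

theorem singleton_mem_faces {s : Finset E3} (hs : s ∈ Γ.faces) {x : E3} (hx : x ∈ s) :
    {x} ∈ Γ.faces :=
  Γ.down_closed hs (Finset.singleton_subset_iff.2 hx) (Finset.singleton_nonempty x)

/-- The orbit of the vertex `x`. -/
def vertexOrbit (L : Submodule ℤ E3) (x : E3) : Set (Set E3) :=
  {B | ∃ v ∈ L, B = (fun y => y + v) '' {x}}

theorem vertexOrbit_eq_iff {x y : E3} :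
    vertexOrbit L x = vertexOrbit L y ↔ ∃ v ∈ L, y = x + v := by
  constructor
  · intro h
    have : ({y} : Set E3) ∈ vertexOrbit L x := h ▸ ⟨0, L.zero_mem, by simp⟩
    obtain ⟨v, hv, h⟩ := this
    exact ⟨v, hv, by simpa using h⟩
  · rintro ⟨v, hv, rfl⟩
    ext B
    constructor
    · rintro ⟨w, hw, rfl⟩
      exact ⟨w - v, L.sub_mem hw hv, by simp⟩
    · rintro ⟨w, hw, rfl⟩
      exact ⟨v + w, L.add_mem hv hw, by simp [add_assoc]⟩

theorem vertexOrbit_mem {x : E3} (hx : x ∈ Γ.vertices) :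
    vertexOrbit L x ∈ orbits L (simplices Γ 1) :=
  ⟨{x}, ⟨{x}, hx, by simp, by simp⟩, rfl⟩

/-- A periodic graph with at most two orbits of vertices has a pair of equal or adjacent vertices
that represents all of them. -/
theorem exists_representatives (hΓ : IsSkeletalGraph Γ) (hL : IsPeriodicGraph L Γ)
    (hfin : (orbits L (simplices Γ 1)).Finite) (h0 : (orbits L (simplices Γ 1)).ncard ≠ 0)
    (h2 : (orbits L (simplices Γ 1)).ncard ≤ 2) :
    ∃ x ∈ Γ.vertices, ∃ y ∈ Γ.vertices, (∃ e ∈ Γ.faces, x ∈ e ∧ y ∈ e) ∧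
      ∀ z ∈ Γ.vertices, ∃ d ∈ ({x, y} : Set E3), ∃ v ∈ L, z = d + v := by
  obtain ⟨_, _, ⟨s, hs, hcard, rfl⟩, rfl⟩ := nonempty_of_ncard_ne_zero h0
  obtain ⟨x, rfl⟩ := Finset.card_eq_one.1 hcard
  refine ⟨x, hs, ?_⟩
  by_cases hall : ∀ z ∈ Γ.vertices, vertexOrbit L x = vertexOrbit L z
  · refine ⟨x, hs, ⟨{x}, hs, by simp, by simp⟩, fun z hz => ⟨x, by simp, ?_⟩⟩
    exact vertexOrbit_eq_iff.1 (hall z hz)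
  push Not at hall
  obtain ⟨z, hz, hxz⟩ := hall
  -- A path from `x` to a vertex outside its orbit has a first step leaving the orbit; translating
  -- that step back gives an edge at `x`.
  have hstep : ∃ a b, ∃ e ∈ Γ.faces, a ∈ e ∧ b ∈ e ∧ vertexOrbit L x = vertexOrbit L a ∧
      vertexOrbit L x ≠ vertexOrbit L b := by
    by_contra! hno
    have hpath := hΓ.2 x hs z hz
    apply hxz
    clear hxz hz
    induction hpath with
    | refl => rfl
    | tail _ hab ih =>
      obtain ⟨e, he, ha, hb⟩ := hab
      exact hno _ _ e he ha hb ih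
  obtain ⟨a, b, e, he, ha, hb, hxa, hxb⟩ := hstep
  obtain ⟨v, hv, rfl⟩ := vertexOrbit_eq_iff.1 hxa
  have he' := hL (-v) (L.neg_mem hv) e he
  have hx' : x ∈ translate (-v) e := mem_translate_neg.2 ha
  have hy' : b - v ∈ translate (-v) e := mem_translate_neg.2 (by simpa using hb)
  have hxy : vertexOrbit L x ≠ vertexOrbit L (b - v) := by
    rwa [vertexOrbit_eq_iff.2 (⟨v, hv, by simp⟩ : ∃ w ∈ L, b = b - v + w)]
  have hyv : b - v ∈ Γ.vertices := singleton_mem_faces he' hy'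
  refine ⟨b - v, hyv, ⟨_, he', hx', hy'⟩, fun z hz => ?_⟩
  by_contra! hno
  have hxz : vertexOrbit L x ≠ vertexOrbit L z := fun h => by
    obtain ⟨w, hw, hzw⟩ := vertexOrbit_eq_iff.1 h
    exact hno x (by simp) w hw hzw
  -- A vertex missed by both representatives would produce a third orbit.
  have hyz : vertexOrbit L (b - v) ≠ vertexOrbit L z := fun h => by
    obtain ⟨w, hw, hzw⟩ := vertexOrbit_eq_iff.1 h
    exact hno (b - v) (by simp) w hw hzw
  have := (two_lt_ncard_iff hfin).2 ⟨_, _, _, vertexOrbit_mem hs, vertexOrbit_mem hyv,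
    vertexOrbit_mem hz, hxy, hxz, hyz⟩
  omega

theorem mem_placements_of_adjacent (hD : IsRegularDecoration Γ solid p q r)
    (hA : IsArchimedean Γ solid) (hΓ : IsSkeletalGraph Γ) {N : ℕ} (h4 : 4 ≤ N)
    (hN : ∀ A ∈ platonicVertexSets ∪ archimedeanVertexSets, A.ncard ≤ N)
    {s t : Finset E3} (hs : s ∈ Γ.faces) (ht : t ∈ Γ.faces) (hadj : Adjacent Γ solid s t)
    (g : E3 ≃ᵈ E3) {k : ℕ} (hk : g '' solid s ∈ placements N k) :
    g '' solid t ∈ placements N (k + 1) := by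
  obtain ⟨A, hAm, hsim⟩ := exists_model hD hA hΓ h4 hN ht hadj.2.2.1
  obtain ⟨h1, h2⟩ := hD.glued s hs t ht hadj
  refine Or.inr ⟨_, hk, A, hAm, hsim.trans ⟨g, rfl⟩, ?_⟩
  rw [← image_inter g.injective]
  exact ⟨h1.similarity_image g, h2.similarity_image g⟩

theorem IsDecoration.nonempty_vertex_solid (hD : IsDecoration Γ solid) {x : E3}
    (hx : {x} ∈ Γ.faces) : (solid {x}).Nonempty :=
  (hD.vertex_solid _ hx (by simp)).2.mono interior_subset

theorem mem_placements_of_mem (hD : IsRegularDecoration Γ solid p q r)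
    (hA : IsArchimedean Γ solid) (hΓ : IsSkeletalGraph Γ) {N : ℕ} (h4 : 4 ≤ N)
    (hN : ∀ A ∈ platonicVertexSets ∪ archimedeanVertexSets, A.ncard ≤ N)
    {s : Finset E3} (hs : s ∈ Γ.faces) {x : E3} (hx : x ∈ s) (hne : (solid s).Nonempty)
    (g : E3 ≃ᵈ E3) {k : ℕ} (hk : g '' solid {x} ∈ placements N k) :
    g '' solid s ∈ placements N (k + 1) := by
  by_cases hxs : {x} = s
  · subst hxs
    exact placements_mono N k.le_succ hk
  have hx' := singleton_mem_faces hs hx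
  exact mem_placements_of_adjacent hD hA hΓ h4 hN hx' hs
    ⟨hxs, hD.nonempty_vertex_solid hx', hne, Or.inl (Finset.singleton_subset_iff.2 hx)⟩ g hk

/-- Passing to a neighbouring vertex costs two gluings, through the edge solid, or a single one if
that solid is empty. -/
theorem mem_placements_of_neighbour (hD : IsRegularDecoration Γ solid p q r)
    (hA : IsArchimedean Γ solid) (hΓ : IsSkeletalGraph Γ) {N : ℕ} (h4 : 4 ≤ N)
    (hN : ∀ A ∈ platonicVertexSets ∪ archimedeanVertexSets, A.ncard ≤ N)
    {e : Finset E3} (he : e ∈ Γ.faces) {x y : E3} (hx : x ∈ e) (hy : y ∈ e)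
    (g : E3 ≃ᵈ E3) {k : ℕ} (hk : g '' solid {x} ∈ placements N k) :
    g '' solid {y} ∈ placements N (k + 2) := by
  have hx' := singleton_mem_faces he hx
  have hy' := singleton_mem_faces he hy
  have hxne := hD.nonempty_vertex_solid hx'
  have hyne := hD.nonempty_vertex_solid hy'
  by_cases hxy : x = y
  · subst hxy
    exact placements_mono N (by omega) hk
  rcases (solid e).eq_empty_or_nonempty with h | h
  · refine placements_mono N (Nat.le_succ _)
      (mem_placements_of_adjacent hD hA hΓ h4 hN hx' hy' ⟨?_, hxne, hyne, ?_⟩ g hk)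
    · simpa using hxy
    · exact Or.inr (Or.inr ⟨e, he, h, by simpa using hx, by simpa using hy⟩)
  · by_cases hey : e = {y}
    · subst hey
      exact absurd (Finset.mem_singleton.1 hx) hxy
    · exact mem_placements_of_adjacent hD hA hΓ h4 hN he hy'
        ⟨hey, h, hyne, Or.inr (Or.inl (by simpa using hy))⟩ g
        (mem_placements_of_mem hD hA hΓ h4 hN he hx h g hk)

/-- In a suitable position, the polyhedron of a periodic regular Archimedean decoration with at most
two orbits of vertices is assembled from finitely many placed polytopes. -/
theorem exists_assembly (hΓ : IsSkeletalGraph Γ) (hL : IsPeriodicGraph L Γ)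
    (hfin : (orbits L (simplices Γ 1)).Finite) (h0 : (orbits L (simplices Γ 1)).ncard ≠ 0)
    (h2 : (orbits L (simplices Γ 1)).ncard ≤ 2) (hP : IsPeriodicDecoration Γ solid L)
    (hA : IsArchimedean Γ solid) (hD : IsRegularDecoration Γ solid p q r) {N : ℕ} (h4 : 4 ≤ N)
    (hN : ∀ A ∈ platonicVertexSets ∪ archimedeanVertexSets, A.ncard ≤ N) :
    ∃ g : E3 ≃ᵈ E3, ∃ V ⊆ placementVectors N 4, ∃ X ⊆ placements N 4,
      g '' polyhedron Γ solid = assembly V X := by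
  obtain ⟨x, hx, y, hy, ⟨e, he, hxe, hye⟩, hcov⟩ := exists_representatives hΓ hL hfin h0 h2
  obtain ⟨A, hAm, hAx⟩ := hA.1 _ hx (by simp)
  obtain ⟨g, hg⟩ := hAx.symm
  obtain ⟨ρ, U, t, hρ, hgU⟩ := exists_similarity_form g
  have hgadd : ∀ a v, g (a + v) = g a + ρ • U v := fun a v => by
    rw [hgU, hgU, map_add, smul_add]
    abel
  have hgtrans : ∀ v (K : Set E3),
      g '' ((fun a => a + v) '' K) = (fun a => a + ρ • U v) '' (g '' K) := by
    intro v K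
    rw [image_image, image_image]
    simp only [hgadd]
  have hx0 : g '' solid {x} ∈ placements N 0 := ⟨A, Or.inl hAm, hg.symm⟩
  -- The solid at `x` is a model in standard position, at level 0; the one at `y` is at most two
  -- gluings away.
  have hD2 : ∀ d ∈ ({x, y} : Set E3), g '' solid {d} ∈ placements N 2 := by
    rintro d (rfl | rfl)
    · exact placements_mono N (by omega) hx0
    · exact mem_placements_of_neighbour hD hA hΓ h4 hN he hxe hye g hx0
  have hDv : ∀ d ∈ ({x, y} : Set E3), {d} ∈ Γ.faces := by
    rintro d (rfl | rfl)
    exacts [hx, hy]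
  -- These are the lattice vectors along which some representative shares a simplex with a translate
  -- of a representative.
  let V₀ : Set E3 := {v | v ∈ L ∧ ∃ d ∈ ({x, y} : Set E3), ∃ d' ∈ ({x, y} : Set E3),
    ∃ s ∈ Γ.faces, d ∈ s ∧ d' + v ∈ s}
  let V : Set E3 := (fun v => ρ • U v) '' V₀
  let X : Set (Set E3) := {K | ∃ s ∈ Γ.faces, (solid s).Nonempty ∧
    (∃ d ∈ ({x, y} : Set E3), d ∈ s) ∧ K = g '' solid s}
  have hclosure : ∀ u ∈ AddSubgroup.closure V, ∃ v ∈ L, u = ρ • U v := by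
    intro u hu
    induction hu using AddSubgroup.closure_induction with
    | mem u hu =>
      obtain ⟨v, hv, rfl⟩ := hu
      exact ⟨v, hv.1, rfl⟩
    | zero => exact ⟨0, L.zero_mem, by simp⟩
    | add a b _ _ ha hb =>
      obtain ⟨v, hv, rfl⟩ := ha
      obtain ⟨w, hw, rfl⟩ := hb
      exact ⟨v + w, L.add_mem hv hw, by rw [map_add, smul_add]⟩
    | neg a _ ha =>
      obtain ⟨v, hv, rfl⟩ := ha
      exact ⟨-v, L.neg_mem hv, by rw [map_neg, smul_neg]⟩
  -- Along a path from `x`, each step changes the lattice vector by an element of `V₀`.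
  have hreach : ∀ z ∈ Γ.vertices, ∃ d ∈ ({x, y} : Set E3), ∃ v ∈ L, z = d + v ∧
      ρ • U v ∈ AddSubgroup.closure V := by
    intro z hz
    have hpath := hΓ.2 x hx z hz
    clear hz
    induction hpath with
    | refl => exact ⟨x, by simp, 0, L.zero_mem, by simp, by simp⟩
    | @tail a b _ hab ih =>
      obtain ⟨s, hs, ha, hb⟩ := hab
      obtain ⟨d, hd, v, hv, rfl, hvV⟩ := ih
      obtain ⟨d', hd', v', hv', rfl⟩ := hcov b (singleton_mem_faces hs hb)
      refine ⟨d', hd', v', hv', rfl, ?_⟩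
      have hmem : v' - v ∈ V₀ := by
        refine ⟨L.sub_mem hv' hv, d, hd, d', hd', _, hL (-v) (L.neg_mem hv) s hs,
          mem_translate_neg.2 ha, mem_translate_neg.2 ?_⟩
        rwa [add_assoc, sub_add_cancel]
      have := AddSubgroup.add_mem _ hvV
        (AddSubgroup.subset_closure (mem_image_of_mem (fun v => ρ • U v) hmem))
      rwa [← smul_add, ← map_add, add_sub_cancel] at this
  refine ⟨g, V, ?_, X, ?_, ?_⟩
  -- Level 4 arises here: representatives lie at level 2, and a neighbour of one of them lies two
  -- gluings further. So both the solid at `d'` and its translate are placed polytopes.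
  · rintro _ ⟨v, ⟨hv, d, hd, d', hd', s, hs, hds, hds'⟩, rfl⟩
    refine ⟨_, placements_mono N (by omega) (hD2 d' hd'),
      (hD.nonempty_vertex_solid (hDv d' hd')).image g, ?_⟩
    have h := hP v hv _ (hDv d' hd')
    rw [translate_singleton] at h
    rw [← hgtrans, ← h]
    exact mem_placements_of_neighbour hD hA hΓ h4 hN hs hds hds' g (hD2 d hd)
  · rintro _ ⟨s, hs, hne, ⟨d, hd, hds⟩, rfl⟩
    exact placements_mono N (by omega)
      (mem_placements_of_mem hD hA hΓ h4 hN hs hds hne g (hD2 d hd))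
  · apply Subset.antisymm
    · rintro _ ⟨a, ha, rfl⟩
      obtain ⟨s, hs, has⟩ := mem_iUnion₂.1 ha
      obtain ⟨z, hz⟩ := Γ.nonempty_of_mem_faces hs
      -- Translating by `-v` moves the simplex to one that contains a representative, whose solid
      -- belongs to `X`.
      obtain ⟨d, hd, v, hv, rfl, hvV⟩ := hreach z (singleton_mem_faces hs hz)
      have hs' := hL (-v) (L.neg_mem hv) s hs
      have hsol := hP v hv _ hs'
      rw [translate_translate_neg] at hsol
      rw [hsol] at has
      have hX : g '' solid (translate (-v) s) ∈ X :=
        ⟨_, hs', (show ((fun x => x + v) '' solid (translate (-v) s)).Nonempty from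
          ⟨a, has⟩).of_image, ⟨d, hd, mem_translate_neg.2 hz⟩, rfl⟩
      refine mem_iUnion₂.2 ⟨_, hvV, mem_iUnion₂.2 ⟨_, hX, ?_⟩⟩
      rw [← hgtrans]
      exact mem_image_of_mem g has
    · intro b hb
      obtain ⟨u, hu, hb⟩ := mem_iUnion₂.1 hb
      obtain ⟨K, ⟨s, hs, -, -, rfl⟩, hb⟩ := mem_iUnion₂.1 hb
      obtain ⟨v, hv, rfl⟩ := hclosure u hu
      rw [← hgtrans, ← hP v hv s hs] at hb
      exact image_mono (subset_biUnion_of_mem (u := solid) (hL v hv s hs)) hb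

end

/-! ### Finiteness up to similarity -/

/-- The surfaces of decorations with one or two orbits of vertices belong, up to similarity, to a
finite set. -/
theorem exists_finite_similar (h g v d : ℕ) (hv : v ≠ 0) (hv2 : v ≤ 2) :
    ∃ T : Set (Set E3), T.Finite ∧
      ∀ S, IsRegularDecorationSurface h g v d S → ∃ S' ∈ T, IsSimilar S S' := by
  obtain ⟨N, h4, hN⟩ := exists_ncard_le
  refine ⟨(fun VX : Set E3 × Set (Set E3) => frontier (assembly VX.1 VX.2)) ''
    (𝒫 placementVectors N 4 ×ˢ 𝒫 placements N 4),
    ((finite_placementVectors N 4).finite_subsets.prod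
      (finite_placements_model N 4).finite_subsets).image _, ?_⟩
  rintro S ⟨L, Γ, solid, p, q, r, -, hΓ, hL, hQ, hP, hA, hD, rfl, -⟩
  obtain ⟨hfin, -, hcard, -⟩ := hQ
  obtain ⟨g, V, hV, X, hX, heq⟩ :=
    exists_assembly hΓ hL hfin (hcard ▸ hv) (hcard ▸ hv2) hP hA hD h4 hN
  refine ⟨_, ⟨(V, X), ⟨hV, hX⟩, rfl⟩, g, ?_⟩
  change _ = frontier (assembly V X)
  rw [← heq]
  exact g.toHomeomorph.image_frontier _

/-- A family of sets contained in finitely many similarity classes has finitely many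
representatives among its own members. -/
theorem exists_finite_representatives {C : Set E3 → Prop} {T : Set (Set E3)} (hT : T.Finite)
    (h : ∀ S, C S → ∃ S' ∈ T, IsSimilar S S') :
    ∃ F : Set (Set E3), F.Finite ∧ (∀ S ∈ F, C S) ∧ ∀ S, C S → ∃ S₀ ∈ F, IsSimilar S S₀ := by
  -- For each similarity class met by the family, one member of the family is selected; classes not
  -- met are discarded.
  choose! f hf using fun (S' : Set E3) (hS' : ∃ S, C S ∧ IsSimilar S S') => hS'
  refine ⟨f '' {S' ∈ T | ∃ S, C S ∧ IsSimilar S S'}, (hT.subset fun _ hS => hS.1).image f, ?_, ?_⟩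
  · rintro _ ⟨S', ⟨-, hS'⟩, rfl⟩
    exact (hf S' hS').1
  · intro S hS
    obtain ⟨S', hS'T, hsim⟩ := h S hS
    have hex : ∃ S, C S ∧ IsSimilar S S' := ⟨S, hS, hsim⟩
    exact ⟨f S', mem_image_of_mem f ⟨hS'T, hex⟩, hsim.trans (hf S' hex).2.symm⟩

end RegularDecoration

end

theorem mainTheorem6 :
    ∃ F : Set (Set RegularDecoration.E3),
      F.Finite ∧
      (∀ S ∈ F, RegularDecoration.IsRegularDecorationSurface 3 3 1 6 S ∨
        RegularDecoration.IsRegularDecorationSurface 3 3 2 4 S) ∧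
      ∀ S : Set RegularDecoration.E3,
        (RegularDecoration.IsRegularDecorationSurface 3 3 1 6 S ∨
          RegularDecoration.IsRegularDecorationSurface 3 3 2 4 S) →
        ∃ S₀ ∈ F, RegularDecoration.IsSimilar S S₀ := by
  obtain ⟨T₁, hT₁, h₁⟩ :=
    RegularDecoration.exists_finite_similar 3 3 1 6 (by norm_num) (by norm_num)
  obtain ⟨T₂, hT₂, h₂⟩ :=
    RegularDecoration.exists_finite_similar 3 3 2 4 (by norm_num) (by norm_num)
  refine RegularDecoration.exists_finite_representatives (hT₁.union hT₂) ?_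
  rintro S (hS | hS)
  · obtain ⟨S', hS', h⟩ := h₁ S hS
    exact ⟨S', Or.inl hS', h⟩
  · obtain ⟨S', hS', h⟩ := h₂ S hS
    exact ⟨S', Or.inr hS', h⟩
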